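/- **Setting.** Let $n=m^2$ and let $R$ be the $\sqrt n\times\sqrt n$ grid of points of the plane with unit spacing, centred in the square $[0,\sqrt n]^2$. A random set $S\subseteq R$ of *nodes* contains each $i\in R$ independently with probability $p_i\in[p_{min},p_{max}]$, where $0<p_{min}\le p_{max}<1$ are constants. A family of disks centred at nodes has cost equal to the sum of the squared radii. It is an $l$-cover of $S$ ($l>0$) if all radii are at least $l$ and every node of $S$ lies in one of the disks. A range assignment $r:S\to[0,\infty)$ has cost $\sum_{v\in S}r(v)^2$; it is a feasible broadcast from a source $s\in S$ if in the digraph with an edge $(u,w)$ whenever $\mathrm{dist}(u,w)\le r(u)$ all nodes are reachable from $s$. A family of disks gives the range assignment in which each node gets the largest radius of a disk centred at it, and $0$ if there is none. **Tiling.** Let $c>0$. Cut off from the square $[0,\sqrt n]^2$ four isosceles right corner triangles with legs $\sqrt n/(2+\sqrt 2)$, so that a regular octagon remains. As long as there is a triangle whose leg $l$ is at least $c\sqrt{\log n}$, divide it into a regular octagon of side $\sqrt2\,l/(\sqrt2+1)^2$ with one side on the hypotenuse and two sides on the legs, two isosceles right triangles with legs $l/(\sqrt2+1)$, and three isosceles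 right triangles with legs $l/(\sqrt2+1)^2$. **The covering $\mathcal{OCT}$** (with a second parameter $K>0$). Each triangle of the final tiling that contains a node selects one of its nodes, which becomes the centre of a disk of radius $c\sqrt{2\log n}$. Then the octagons are examined one by one, in any order: if an octagon contains a node not covered yet, a node at distance at most $K\sqrt{\log n}$ from its centre is selected and becomes the centre of a disk of radius $r+K\sqrt{\log n}$, where $r$ is the circumradius of the octagon; otherwise the octagon gets no disk. **Theorem.** For all $p_{min},p_{max},c$ as above there is $K_0>0$ such that for every $K\ge K_0$ there are constants $a,B,D>0$ and a function $\mathrm{err}(n)=o(n)$ such that, for all sufficiently large perfect squares $n$ and all $p_i\in[p_{min},p_{max}]$, the following holds with probability at least $1-n^{-a}$. A covering $\mathcal{OCT}$ of $S$ exists, and for every such covering (whatever choices are made): 1. $\mathcal{OCT}$ is an $l$-cover of $S$ with $l=\min(\sqrt2\,c,K)\sqrt{\log n}$; 2. $\mathrm{cost}(\mathcal{OCT})\le 1.12\,\frac n\pi+\mathrm{err}(n)$ (so in particular it is at most $1.1204\,\frac n\pi+o(n)$); 3. for every source $s\in S$ there are relay nodes in $S$ such that $s$ is joined to the centre of every disk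 of $\mathcal{OCT}$ by a chain of disks of radius $B\sqrt{\log n}$ centred at relays (each disk containing the next node of the chain), the total cost of the relay disks is at most $D\,n^{0.63}$, and the range assignment $r$ given by the disks of $\mathcal{OCT}$ together with the relay disks is a feasible broadcast from $s$ with $\mathrm{cost}(r)\le\mathrm{cost}(\mathcal{OCT})+D\,n^{0.63}$ and $\mathrm{cost}(r)\le 1.12\,\frac n\pi+\mathrm{err}(n)$. -/

import Mathlib

open scoped BigOperators

noncomputable section

namespace RandomGrid

/-! ### Random grid sets -/

/-- The Euclidean plane. -/
abbrev Plane := EuclideanSpace ℝ (Fin 2)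

/-- The `√n × √n` grid, with `n = m ^ 2` points. -/
abbrev Grid (m : ℕ) := Fin m × Fin m

/-- The position of a grid point: adjacent points are at distance `1`, and the grid is centred
in the square `[0, m] × [0, m]`. -/
def pos {m : ℕ} (v : Grid m) : Plane := !₂[(v.1 : ℝ) + 1 / 2, (v.2 : ℝ) + 1 / 2]

/-- The probability `∏_{i ∈ S} p i * ∏_{i ∉ S} (1 - p i)` of the set `S` of nodes, when every
grid point `i` is selected independently with probability `p i`. -/
def setProb {m : ℕ} (p : Grid m → ℝ) (S : Finset (Grid m)) : ℝ :=
  (∏ i ∈ S, p i) * ∏ i ∈ Sᶜ, (1 - p i)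

open Classical in
/-- The probability that a random set has the property `E`. -/
def prob {m : ℕ} (p : Grid m → ℝ) (E : Finset (Grid m) → Prop) : ℝ :=
  ∑ S : Finset (Grid m) with E S, setProb p S

/-- The quantity `√(log n)` for `n = m ^ 2`. -/
def sqrtLog (m : ℕ) : ℝ := √(Real.log ((m : ℝ) ^ 2))

/-! ### Disks, covers, range assignments, broadcast -/

/-- A disk centred at a grid point. -/
structure Disk (m : ℕ) where
  center : Grid m
  radius : ℝ

/-- The (closed) disk `d` contains the grid point `v`. -/
def Disk.Covers {m : ℕ} (d : Disk m) (v : Grid m) : Prop :=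
  dist (pos d.center) (pos v) ≤ d.radius

/-- The energy cost of a family of disks: the sum of the squared radii. -/
def diskCost {m : ℕ} (C : List (Disk m)) : ℝ := (C.map fun d => d.radius ^ 2).sum

/-- `C` is an `l`-cover of `S`: all radii are at least `l > 0`, all centres are nodes of `S`, and
every node of `S` is covered. -/
structure IsCover {m : ℕ} (l : ℝ) (S : Finset (Grid m)) (C : List (Disk m)) : Prop where
  pos : 0 < l
  radius_ge : ∀ d ∈ C, l ≤ d.radius
  center_mem : ∀ d ∈ C, d.center ∈ S
  covers : ∀ v ∈ S, ∃ d ∈ C, d.Covers v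

/-- The range assignment of a family of disks: a node gets the largest radius of a disk centred
at it, and range `0` if there is none. -/
def rangeOf {m : ℕ} (C : List (Disk m)) (v : Grid m) : ℝ :=
  ((C.filter fun d => d.center = v).map Disk.radius).foldr max 0

/-- The energy cost of a range assignment on the node set `S`. -/
def rangeCost {m : ℕ} (S : Finset (Grid m)) (r : Grid m → ℝ) : ℝ := ∑ v ∈ S, r v ^ 2

/-- The range assignment `r` is a feasible broadcast from the source `s`: in the directed
communication graph on `S` (with an edge from `u` to `w` iff `w` is within range of `u`) every
node is reachable from `s`, that is, there is a directed spanning tree rooted at `s`. -/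
def IsBroadcast {m : ℕ} (S : Finset (Grid m)) (s : Grid m) (r : Grid m → ℝ) : Prop :=
  ∀ v ∈ S, Relation.ReflTransGen
    (fun u w => u ∈ S ∧ w ∈ S ∧ dist (pos u) (pos w) ≤ r u) s v

/-- The chain disks: one disk of radius `ρ` at every relay. -/
def chainDisks {m : ℕ} (ρ : ℝ) (relays : List (Grid m)) : List (Disk m) :=
  relays.map fun v => ⟨v, ρ⟩

/-- `s` is joined to `z` by a chain of disks of radius `ρ`: there are `s = v₀, v₁, …, vₖ = z`, all
of `v₀, …, vₖ₋₁` being relays, with consecutive distances at most `ρ`. -/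
def ChainJoined {m : ℕ} (ρ : ℝ) (relays : List (Grid m)) (s z : Grid m) : Prop :=
  Relation.ReflTransGen (fun u w => u ∈ relays ∧ dist (pos u) (pos w) ≤ ρ) s z

/-! ### The recursive tiling of the square into octagons and triangles -/

/-- An isosceles right triangle, given by its right-angled vertex `o` and its two legs `u`, `v`
(in use, orthogonal vectors of the same length). -/
structure Triangle where
  o : Plane
  u : Plane
  v : Plane

/-- The closed triangle with vertices `o`, `o + u`, `o + v`. -/
def Triangle.region (T : Triangle) : Set Plane :=
  {x | ∃ a b : ℝ, 0 ≤ a ∧ 0 ≤ b ∧ a + b ≤ 1 ∧ x = T.o + a • T.u + b • T.v}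

/-- A regular octagon, given by its circumscribed square with vertex `o` and edges `U`, `V` (in
use, orthogonal vectors of the same length). -/
structure Octagon where
  o : Plane
  U : Plane
  V : Plane

/-- The ratio `l / (2 l + √2 l)` between the leg `l` of a triangle cut off at a corner of a square
and the side of the square, when a regular octagon remains. -/
def cut : ℝ := 1 / (2 + √2)

/-- The closed octagon: the square without its four corner triangles. Its vertices are
`o + cut • U`, `o + (1 - cut) • U`, `o + U + cut • V`, and so on. -/
def Octagon.region (Q : Octagon) : Set Plane :=
  {x | ∃ a b : ℝ, 0 ≤ a ∧ a ≤ 1 ∧ 0 ≤ b ∧ b ≤ 1 ∧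
    cut ≤ a + b ∧ cut ≤ (1 - a) + b ∧ cut ≤ a + (1 - b) ∧ cut ≤ (1 - a) + (1 - b) ∧
    x = Q.o + a • Q.U + b • Q.V}

/-- The centre of the octagon. -/
def Octagon.center (Q : Octagon) : Plane := Q.o + (1 / 2 : ℝ) • (Q.U + Q.V)

/-- The radius of the circumscribed disk: the distance from the centre to a vertex. -/
def Octagon.radius (Q : Octagon) : ℝ := dist Q.center (Q.o + cut • Q.U)

/-- The shrinking factor of one step: the bigger triangles produced from a triangle with leg `l`
have leg `q * l`, the smaller ones have leg `q ^ 2 * l`. -/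
def q : ℝ := 1 / (√2 + 1)

/-- The octagon produced from a triangle with leg `l`. Its circumscribed square has the
right-angled vertex in common with the triangle, and its side is `(1 - q) * l`; the side of the
octagon opposite to that vertex lies on the hypotenuse. -/
def Triangle.octagon (T : Triangle) : Octagon := ⟨T.o, (1 - q) • T.u, (1 - q) • T.v⟩

/-- The two bigger triangles produced from a triangle. -/
def Triangle.big (T : Triangle) : List Triangle :=
  [⟨T.o + (1 - q) • T.u, q • T.u, q • T.v⟩,
   ⟨T.o + (1 - q) • T.v, q • T.u, q • T.v⟩]

/-- The three smaller triangles produced from a triangle. -/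
def Triangle.small (T : Triangle) : List Triangle :=
  [⟨T.o, q ^ 2 • T.u, q ^ 2 • T.v⟩,
   ⟨T.o + (1 - q) • T.u, -(q ^ 2 • T.u), q ^ 2 • T.v⟩,
   ⟨T.o + (1 - q) • T.v, q ^ 2 • T.u, -(q ^ 2 • T.v)⟩]

/-- The triangles left when a triangle is subdivided recursively. The number `k` says how many
more times the leg has to be multiplied by `q` before subdivision stops; it drops by one for the
bigger and by two for the smaller triangles. -/
def Triangle.finalTriangles : ℕ → Triangle → List Triangle
  | 0, T => [T]
  | 1, T => T.big ++ T.small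
  | k + 2, T =>
      T.big.flatMap (Triangle.finalTriangles (k + 1)) ++ T.small.flatMap (Triangle.finalTriangles k)

/-- The octagons produced when a triangle is subdivided recursively. -/
def Triangle.octagons : ℕ → Triangle → List Octagon
  | 0, _ => []
  | 1, T => [T.octagon]
  | k + 2, T =>
      T.octagon :: (T.big.flatMap (Triangle.octagons (k + 1)) ++
        T.small.flatMap (Triangle.octagons k))

/-- The four corner triangles of the first step, in the square `[0, m] × [0, m]`. -/
def corners (m : ℕ) : List Triangle :=
  let l : ℝ := cut * m
  [⟨!₂[0, 0], !₂[l, 0], !₂[0, l]⟩,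
   ⟨!₂[(m : ℝ), 0], !₂[-l, 0], !₂[0, l]⟩,
   ⟨!₂[0, (m : ℝ)], !₂[l, 0], !₂[0, -l]⟩,
   ⟨!₂[(m : ℝ), (m : ℝ)], !₂[-l, 0], !₂[0, -l]⟩]

/-- The octagon of the first step, in the square `[0, m] × [0, m]`. -/
def firstOctagon (m : ℕ) : Octagon := ⟨!₂[0, 0], !₂[(m : ℝ), 0], !₂[0, (m : ℝ)]⟩

/-- The smallest `k` such that the leg `√n / ((2 + √2) (√2 + 1) ^ k)` is less than `c √(log n)`: a
triangle is subdivided exactly as long as its leg is at least `c √(log n)`. -/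
def depth (m : ℕ) (c : ℝ) : ℕ := sInf {k : ℕ | cut * m * q ^ k < c * sqrtLog m}

/-- The triangles of the final tiling. -/
def triangles (m : ℕ) (c : ℝ) : List Triangle :=
  (corners m).flatMap (Triangle.finalTriangles (depth m c))

/-- The octagons of the final tiling. -/
def octagons (m : ℕ) (c : ℝ) : List Octagon :=
  firstOctagon m :: (corners m).flatMap (Triangle.octagons (depth m c))

/-! ### The disk covering OCT -/

/-- A choice of at most one node for every triangle and every octagon. -/
structure Selection (m : ℕ) where
  tri : Triangle → Option (Grid m)
  oct : Octagon → Option (Grid m)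

/-- The disks of the triangles, with radius `c √(2 log n)`. -/
def Selection.triDisks {m : ℕ} (σ : Selection m) (c : ℝ) : List (Disk m) :=
  (triangles m c).filterMap fun T => (σ.tri T).map fun v => ⟨v, √2 * c * sqrtLog m⟩

/-- The disk of an octagon centred at `v`: its radius exceeds that of the circumscribed disk by
`K √(log n)`. -/
def octDisk {m : ℕ} (K : ℝ) (Q : Octagon) (v : Grid m) : Disk m := ⟨v, Q.radius + K * sqrtLog m⟩

/-- The disks of the octagons. -/
def Selection.octDisks {m : ℕ} (σ : Selection m) (c K : ℝ) : List (Disk m) :=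
  (octagons m c).filterMap fun Q => (σ.oct Q).map (octDisk K Q)

/-- All disks of the selection. -/
def Selection.disks {m : ℕ} (σ : Selection m) (c K : ℝ) : List (Disk m) :=
  σ.triDisks c ++ σ.octDisks c K

/-- `v` is already covered, before the octagon `Q` is examined, by the disk of a triangle or by
that of an octagon examined earlier. -/
def Selection.CoveredBefore {m : ℕ} (σ : Selection m) (c K : ℝ) (rank : Octagon → ℕ) (Q : Octagon)
    (v : Grid m) : Prop :=
  (∃ d ∈ σ.triDisks c, d.Covers v) ∨
    ∃ Q' ∈ octagons m c, rank Q' < rank Q ∧ ∃ z, σ.oct Q' = some z ∧ (octDisk K Q' z).Covers v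

/-- The selection yields a disk covering OCT of `S`. Every triangle that contains a node selects
one of its nodes. Then the octagons are examined one after the other, in some order: an octagon
with a node that is not covered yet selects a node at distance at most `K √(log n)` from the
centre of the octagon; the other octagons select nothing. -/
structure IsOCT {m : ℕ} (c K : ℝ) (S : Finset (Grid m)) (σ : Selection m) : Prop where
  tri_some : ∀ T ∈ triangles m c, (∃ v ∈ S, pos v ∈ T.region) →
    ∃ v ∈ S, pos v ∈ T.region ∧ σ.tri T = some v
  tri_none : ∀ T ∈ triangles m c, (¬ ∃ v ∈ S, pos v ∈ T.region) → σ.tri T = none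
  oct : ∃ rank : Octagon → ℕ, Set.InjOn rank {Q | Q ∈ octagons m c} ∧
    ∀ Q ∈ octagons m c,
      ((∃ v ∈ S, pos v ∈ Q.region ∧ ¬ σ.CoveredBefore c K rank Q v) →
        ∃ z ∈ S, dist (pos z) Q.center ≤ K * sqrtLog m ∧ σ.oct Q = some z) ∧
      ((¬ ∃ v ∈ S, pos v ∈ Q.region ∧ ¬ σ.CoveredBefore c K rank Q v) → σ.oct Q = none)

end RandomGrid

end

namespace RandomGrid

/-! ### Constants of the tiling -/

/-! The leading term of the cost is an area. A regular octagon of circumradius `r` has area `2√2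
r²`, and the octagons tile part of a square of area `n`, so their squared radii sum to at most
`n/(2√2) = (√2/4) n`, which is below `1.12 n/π` because `π√2/4 ≈ 1.111`. No measure theory is
needed: `Triangle.Good.octagon_radius_sq` gives each octagon its share of the triangle, and the
shares add up along the recursion (`Triangle.Good.sum_radius_sq_le`). Only the fact that the pieces
cover the square is used geometrically (`exists_tile`).

All other costs are controlled by one count. A triangle with `k + 1` steps left produces two with
`k` steps and three with `k - 1`, and `x² = 2x + 3` has the root 3, so there are `O(3 ^ k)` pieces.
The sum of the leg lengths, measured in units of the last leg, obeys the same recursion with forcing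
term `grow ^ (k + 1)`; since `grow < 3` it is `O(3 ^ k)` too (`countBound`). The depth is about `log
m / log grow` and `3 ≤ grow ^ (5/4)`, so `3 ^ depth = O(m ^ (5/4)) = O(n ^ 0.625)`. This pays for
the triangle disks, for enlarging the octagon radii by `K √(log n)`, and for the relays; the factor
`log n` fits between the exponents 0.625 and 0.63.

Randomness enters once (`exists_prob_dense`): by a union bound, with probability at least `1 - 1/n`
every point of the square has a node within `κ √(log n)`. Everything else is deterministic given
this event. It provides the octagon centres and lets any segment be followed by relays; the relay
chains run along a tree of segments that mirrors the subdivision (`Triangle.Good.exists_relays`). -/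

/-- The inverse `√2 + 1` of the shrinking factor `q`. -/
noncomputable def grow : ℝ := √2 + 1

lemma sqrt_two_sq : √2 * √2 = 2 := Real.mul_self_sqrt (by norm_num)

lemma grow_pos : 0 < grow := by unfold grow; positivity

lemma q_mul_grow : q * grow = 1 := by
  have := grow_pos
  unfold q grow at *
  field_simp

lemma q_eq : q = √2 - 1 := by
  have h := q_mul_grow
  have : (q - (√2 - 1)) * grow = 0 := by
    rw [sub_mul, h]; unfold grow; nlinarith [sqrt_two_sq]
  rcases mul_eq_zero.mp this with h | h
  · linarith
  · exact absurd h grow_pos.ne'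

lemma sqrt_two_eq : √2 = q + 1 := by rw [q_eq]; ring

lemma grow_eq : grow = q + 2 := by rw [q_eq]; unfold grow; ring

lemma q_sq : q ^ 2 = 1 - 2 * q := by rw [q_eq]; nlinarith [sqrt_two_sq]

lemma q_pos : 0 < q := by unfold q; positivity

lemma q_lt : q < 0.4143 := by
  have := q_sq
  have := q_pos
  nlinarith

lemma q_gt : 0.4142 < q := by
  have := q_sq
  have := q_pos
  nlinarith

lemma cut_eq : cut = (1 - q) / 2 := by
  unfold cut
  rw [q_eq, div_eq_div_iff (by positivity) (by norm_num)]
  nlinarith [sqrt_two_sq]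

/-! ### The shape of the triangles and octagons -/

/-- `T` is an isosceles right triangle with legs at most `b` and vertices in `A`. -/
structure Triangle.Good (A : Set Plane) (b : ℝ) (T : Triangle) : Prop where
  orth : inner ℝ T.u T.v = 0
  norm_eq : ‖T.v‖ = ‖T.u‖
  norm_le : ‖T.u‖ ≤ b
  o_mem : T.o ∈ A
  u_mem : T.o + T.u ∈ A
  v_mem : T.o + T.v ∈ A

lemma Triangle.Good.mono {A : Set Plane} {b b' : ℝ} {T : Triangle} (h : T.Good A b)
    (hb : b ≤ b') : T.Good A b' :=
  ⟨h.orth, h.norm_eq, h.norm_le.trans hb, h.o_mem, h.u_mem, h.v_mem⟩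

lemma Triangle.Good.mem {A : Set Plane} (hA : Convex ℝ A) {b : ℝ} {T : Triangle}
    (h : T.Good A b) {α β : ℝ} (hα : 0 ≤ α) (hβ : 0 ≤ β) (hαβ : α + β ≤ 1) :
    T.o + α • T.u + β • T.v ∈ A := by
  have key := hA.sum_mem (t := Finset.univ) (w := ![1 - α - β, α, β])
    (z := ![T.o, T.o + T.u, T.o + T.v])
    (by intro i _; fin_cases i <;> simp <;> linarith)
    (by simp [Fin.sum_univ_three]; ring)
    (by intro i _; fin_cases i <;> simp [h.o_mem, h.u_mem, h.v_mem])
  convert key using 1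
  simp [Fin.sum_univ_three]
  module

lemma norm_combination_sq {u v : Plane} (huv : inner ℝ u v = 0) (hn : ‖v‖ = ‖u‖) (α β : ℝ) :
    ‖α • u + β • v‖ ^ 2 = (α ^ 2 + β ^ 2) * ‖u‖ ^ 2 := by
  rw [norm_add_sq_real, inner_smul_left, inner_smul_right, huv, norm_smul, norm_smul, hn,
    mul_pow, mul_pow, Real.norm_eq_abs, Real.norm_eq_abs, sq_abs, sq_abs]
  simp
  ring

lemma Triangle.Good.big {A : Set Plane} (hA : Convex ℝ A) {b : ℝ} {T T' : Triangle}
    (h : T.Good A b) (hT' : T' ∈ T.big) : T'.Good A (q * b) := by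
  have h1 := q_lt
  have h0 := q_pos
  have hm := fun {α β : ℝ} => h.mem hA (α := α) (β := β)
  simp only [Triangle.big, List.mem_cons, List.not_mem_nil, or_false] at hT'
  rcases hT' with rfl | rfl
  all_goals
    refine ⟨by simp [inner_smul_left, inner_smul_right, h.orth], by simp [norm_smul, h.norm_eq],
      ?_, ?_, ?_, ?_⟩
    · simp only [norm_smul, Real.norm_eq_abs, abs_of_pos h0]
      exact mul_le_mul_of_nonneg_left h.norm_le h0.le
  · convert hm (α := 1 - q) (β := 0) (by linarith) (by linarith) (by linarith) using 1
    simp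
  · convert hm (α := 1) (β := 0) (by linarith) (by linarith) (by linarith) using 1
    module
  · convert hm (α := 1 - q) (β := q) (by linarith) (by linarith) (by linarith) using 1
  · convert hm (α := 0) (β := 1 - q) (by linarith) (by linarith) (by linarith) using 1
    simp
  · convert hm (α := q) (β := 1 - q) (by linarith) (by linarith) (by linarith) using 1
    module
  · convert hm (α := 0) (β := 1) (by linarith) (by linarith) (by linarith) using 1
    module

lemma Triangle.Good.small {A : Set Plane} (hA : Convex ℝ A) {b : ℝ} {T T' : Triangle}
    (h : T.Good A b) (hT' : T' ∈ T.small) : T'.Good A (q ^ 2 * b) := by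
  have h1 := q_lt
  have h4 := q_gt
  have h0 := q_pos
  have h2 := q_sq
  have h3 : 0 < q ^ 2 := by positivity
  have hm := fun {α β : ℝ} => h.mem hA (α := α) (β := β)
  simp only [Triangle.small, List.mem_cons, List.not_mem_nil, or_false] at hT'
  rcases hT' with rfl | rfl | rfl
  all_goals
    refine ⟨by simp [inner_smul_left, inner_smul_right, h.orth], by simp [norm_smul, h.norm_eq],
      ?_, ?_, ?_, ?_⟩
    · simp only [norm_neg, norm_smul, Real.norm_eq_abs, abs_of_pos h3]
      exact mul_le_mul_of_nonneg_left h.norm_le h3.le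
  · exact h.o_mem
  · convert hm (α := q ^ 2) (β := 0) (by linarith) (by linarith) (by linarith) using 1
    simp
  · convert hm (α := 0) (β := q ^ 2) (by linarith) (by linarith) (by linarith) using 1
    simp
  · convert hm (α := 1 - q) (β := 0) (by linarith) (by linarith) (by linarith) using 1
    simp
  · convert hm (α := 1 - q - q ^ 2) (β := 0) (by linarith) (by linarith) (by linarith) using 1
    module
  · convert hm (α := 1 - q) (β := q ^ 2) (by linarith) (by linarith) (by linarith) using 1
  · convert hm (α := 0) (β := 1 - q) (by linarith) (by linarith) (by linarith) using 1
    simp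
  · convert hm (α := q ^ 2) (β := 1 - q) (by linarith) (by linarith) (by linarith) using 1
    module
  · convert hm (α := 0) (β := 1 - q - q ^ 2) (by linarith) (by linarith) (by linarith) using 1
    module

lemma Triangle.Good.dist_le {A : Set Plane} {b : ℝ} {T : Triangle} (h : T.Good A b) {x y : Plane}
    (hx : x ∈ T.region) (hy : y ∈ T.region) : dist x y ≤ √2 * b := by
  obtain ⟨a₁, b₁, ha₁, hb₁, hab₁, rfl⟩ := hx
  obtain ⟨a₂, b₂, ha₂, hb₂, hab₂, rfl⟩ := hy
  have hb : 0 ≤ b := (norm_nonneg _).trans h.norm_le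
  have e : T.o + a₁ • T.u + b₁ • T.v - (T.o + a₂ • T.u + b₂ • T.v)
      = (a₁ - a₂) • T.u + (b₁ - b₂) • T.v := by module
  rw [dist_eq_norm, e]
  refine abs_le_of_sq_le_sq' ?_ (by positivity) |>.2
  rw [norm_combination_sq h.orth h.norm_eq, mul_pow, Real.sq_sqrt (by norm_num)]
  have h1 : (a₁ - a₂) ^ 2 ≤ 1 := by rw [sq_le_one_iff_abs_le_one, abs_le]; constructor <;> linarith
  have h2 : (b₁ - b₂) ^ 2 ≤ 1 := by rw [sq_le_one_iff_abs_le_one, abs_le]; constructor <;> linarith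
  exact mul_le_mul (by linarith) (pow_le_pow_left₀ (norm_nonneg _) h.norm_le 2)
    (by positivity) (by norm_num)

/-- The circumscribed square of the octagon is a square. -/
structure Octagon.Regular (Q : Octagon) : Prop where
  orth : inner ℝ Q.U Q.V = 0
  norm_eq : ‖Q.V‖ = ‖Q.U‖

lemma Octagon.radius_nonneg (Q : Octagon) : 0 ≤ Q.radius := dist_nonneg

lemma Octagon.Regular.radius_sq {Q : Octagon} (h : Q.Regular) :
    Q.radius ^ 2 = (1 / 4 + (1 / 2 - cut) ^ 2) * ‖Q.U‖ ^ 2 := by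
  have e : Q.center - (Q.o + cut • Q.U) = (1 / 2 - cut) • Q.U + (1 / 2 : ℝ) • Q.V := by
    unfold Octagon.center; module
  rw [Octagon.radius, dist_eq_norm, e, norm_combination_sq h.orth h.norm_eq]
  ring

/-- A convex function on the part of the octagon between an axis and a diagonal is largest at a
vertex. Here `s`, `t` are centred coordinates, and the maximum is at the octagon vertex `(1/2, h)`.
-/
lemma sq_add_sq_le_of_octagon {s t h : ℝ} (ht : 0 ≤ t) (hs : s ≤ 1 / 2) (hts : t ≤ s)
    (h0 : 0 ≤ h) (hh : h ≤ 1 / 2) (hst : s + t ≤ 1 / 2 + h) :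
    s ^ 2 + t ^ 2 ≤ 1 / 4 + h ^ 2 := by
  rcases le_total t h with hth | hth
  · nlinarith
  · nlinarith [mul_nonneg (sub_nonneg.2 hth) (sub_nonneg.2 hts),
      mul_nonneg (sub_nonneg.2 hs) (sub_nonneg.2 hts), mul_nonneg (sub_nonneg.2 hs) (sub_nonneg.2 hh)]

lemma Octagon.Regular.dist_center_le {Q : Octagon} (h : Q.Regular) {x : Plane}
    (hx : x ∈ Q.region) : dist Q.center x ≤ Q.radius := by
  obtain ⟨a, b, ha, ha', hb, hb', h1, h2, h3, h4, rfl⟩ := hx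
  have e : Q.center - (Q.o + a • Q.U + b • Q.V) = (1 / 2 - a) • Q.U + (1 / 2 - b) • Q.V := by
    unfold Octagon.center; module
  refine abs_le_of_sq_le_sq' ?_ Q.radius_nonneg |>.2
  rw [dist_eq_norm, e, norm_combination_sq h.orth h.norm_eq, h.radius_sq]
  refine mul_le_mul_of_nonneg_right ?_ (by positivity)
  have hc : cut = (1 - q) / 2 := cut_eq
  have h5 := q_lt
  have h6 := q_pos
  rw [← sq_abs (1 / 2 - a), ← sq_abs (1 / 2 - b)]
  have hsa : |1 / 2 - a| ≤ 1 / 2 := by rw [abs_le]; constructor <;> linarith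
  have hsb : |1 / 2 - b| ≤ 1 / 2 := by rw [abs_le]; constructor <;> linarith
  have hsum : |1 / 2 - a| + |1 / 2 - b| ≤ 1 / 2 + (1 / 2 - cut) := by
    rcases abs_cases (1 / 2 - a) with ⟨e1, _⟩ | ⟨e1, _⟩ <;>
    rcases abs_cases (1 / 2 - b) with ⟨e2, _⟩ | ⟨e2, _⟩ <;> rw [e1, e2] <;> linarith
  rcases le_total |1 / 2 - b| |1 / 2 - a| with hab | hab
  · exact sq_add_sq_le_of_octagon (abs_nonneg _) hsa hab (by linarith) (by linarith) hsum
  · rw [add_comm]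
    exact sq_add_sq_le_of_octagon (abs_nonneg _) hsb hab (by linarith) (by linarith)
      (by rw [add_comm]; exact hsum)

lemma Triangle.Good.regular {A : Set Plane} {b : ℝ} {T : Triangle} (h : T.Good A b) :
    T.octagon.Regular := by
  refine ⟨by simp [Triangle.octagon, inner_smul_left, inner_smul_right, h.orth],
    by simp [Triangle.octagon, norm_smul, h.norm_eq]⟩

lemma Triangle.norm_octagon (T : Triangle) : ‖T.octagon.U‖ = (1 - q) * ‖T.u‖ := by
  have := q_lt
  simp [Triangle.octagon, norm_smul, abs_of_pos (show 0 < 1 - q by linarith)]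

/-- The squared radius is the area over `2√2`. The factor `1 - 2 q² - 3 q⁴` is the share of the area
left after removing two triangles of ratio `q` and three of ratio `q²`; this form makes the sum over
the recursion telescope. -/
lemma Triangle.Good.octagon_radius_sq {A : Set Plane} {b : ℝ} {T : Triangle} (h : T.Good A b) :
    T.octagon.radius ^ 2 = (1 + q) / 8 * (‖T.u‖ ^ 2 * (1 - 2 * q ^ 2 - 3 * q ^ 4)) := by
  rw [h.regular.radius_sq, T.norm_octagon, cut_eq]
  have h2 := q_sq
  have h4 : q ^ 4 = 5 - 12 * q := by nlinarith
  have h3 : q ^ 3 = 5 * q - 2 := by nlinarith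
  have : (1 / 4 + (1 / 2 - (1 - q) / 2) ^ 2) * (1 - q) ^ 2
      = (1 + q) / 8 * (1 - 2 * q ^ 2 - 3 * q ^ 4) := by
    ring_nf
    have h5 : q ^ 5 = 29 * q - 12 := by nlinarith
    rw [h2, h3, h4, h5]; ring
  linear_combination ‖T.u‖ ^ 2 * this

lemma Triangle.Good.octagon_radius_le {A : Set Plane} {b : ℝ} {T : Triangle} (h : T.Good A b) :
    T.octagon.radius ≤ b := by
  refine (abs_le_of_sq_le_sq' ?_ (norm_nonneg T.u) |>.2).trans h.norm_le
  rw [h.octagon_radius_sq]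
  have h1 := q_lt
  have h0 := q_pos
  have : (1 + q) / 8 * (1 - 2 * q ^ 2 - 3 * q ^ 4) ≤ 1 * 1 :=
    mul_le_mul (by linarith) (by nlinarith [pow_pos h0 2, pow_pos h0 4])
      (by nlinarith [q_sq, q_gt]) (by norm_num)
  nlinarith [sq_nonneg ‖T.u‖]

lemma Triangle.Good.octagon_center_mem {A : Set Plane} (hA : Convex ℝ A) {b : ℝ} {T : Triangle}
    (h : T.Good A b) : T.octagon.center ∈ A := by
  have h1 := q_lt
  have h0 := q_pos
  convert h.mem hA (α := (1 - q) / 2) (β := (1 - q) / 2) (by linarith) (by linarith)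
    (by linarith) using 1
  simp only [Octagon.center, Triangle.octagon]
  module

lemma Triangle.Good.dist_octagon_center_le {A : Set Plane} {b : ℝ} {T : Triangle}
    (h : T.Good A b) : dist T.o T.octagon.center ≤ b := by
  have h1 := q_lt
  have h0 := q_pos
  have e : T.o - T.octagon.center = (-((1 - q) / 2)) • T.u + (-((1 - q) / 2)) • T.v := by
    simp only [Octagon.center, Triangle.octagon]; module
  refine (abs_le_of_sq_le_sq' ?_ (norm_nonneg T.u) |>.2).trans h.norm_le
  rw [dist_eq_norm, e, norm_combination_sq h.orth h.norm_eq]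
  refine mul_le_of_le_one_left (by positivity) ?_
  nlinarith

lemma Triangle.Good.dist_child_le {A : Set Plane} {b : ℝ} {T T' : Triangle} (h : T.Good A b)
    (hT' : T' ∈ T.big ++ T.small) : dist T.o T'.o ≤ b := by
  have h1 := q_lt
  have h0 := q_pos
  have hb := (norm_nonneg _).trans h.norm_le
  have hu : ‖(1 - q) • T.u‖ ≤ b := by
    rw [norm_smul, Real.norm_eq_abs, abs_of_pos (by linarith)]
    nlinarith [norm_nonneg T.u, h.norm_le]
  have hv : ‖(1 - q) • T.v‖ ≤ b := by
    rw [norm_smul, h.norm_eq, ← norm_smul]; exact hu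
  simp only [Triangle.big, Triangle.small, List.cons_append, List.nil_append, List.mem_cons,
    List.not_mem_nil, or_false] at hT'
  rcases hT' with rfl | rfl | rfl | rfl | rfl <;> simp [hu, hv, hb]

/-! ### One subdivision step -/

/-- In the coordinates `a`, `b` along the legs, a point beyond `1 - q` in either one lies in a
bigger triangle. The rest lies in the circumscribed square of the octagon, where three corners are
the smaller triangles and the fourth is cut off by the hypotenuse. -/
lemma Triangle.region_subset (T : Triangle) {x : Plane} (hx : x ∈ T.region) :
    x ∈ T.octagon.region ∨ (∃ T' ∈ T.big, x ∈ T'.region) ∨ ∃ T' ∈ T.small, x ∈ T'.region := by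
  obtain ⟨a, b, ha, hb, hab, rfl⟩ := hx
  have h1 := q_lt
  have h0 := q_pos
  have h2 := q_sq
  have hq2 : 0 < q ^ 2 := by positivity
  have hq1 : 0 < 1 - q := by linarith
  by_cases ha1 : 1 - q ≤ a
  · refine Or.inr (Or.inl ⟨_, List.mem_cons_self, (a - (1 - q)) / q, b / q,
      div_nonneg (by linarith) h0.le, by positivity, ?_, ?_⟩)
    · rw [← add_div, div_le_one h0]; linarith
    · simp only [smul_smul, div_mul_cancel₀ _ h0.ne']; module
  by_cases hb1 : 1 - q ≤ b
  · refine Or.inr (Or.inl ⟨_, List.mem_cons_of_mem _ List.mem_cons_self, a / q, (b - (1 - q)) / q,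
      by positivity, div_nonneg (by linarith) h0.le, ?_, ?_⟩)
    · rw [← add_div, div_le_one h0]; linarith
    · simp only [smul_smul, div_mul_cancel₀ _ h0.ne']; module
  push Not at ha1 hb1
  by_cases h3 : a + b < q ^ 2
  · refine Or.inr (Or.inr ⟨_, List.mem_cons_self, a / q ^ 2, b / q ^ 2, by positivity,
      by positivity, ?_, ?_⟩)
    · rw [← add_div, div_le_one hq2]; linarith
    · simp only [smul_smul, div_mul_cancel₀ _ hq2.ne']
  by_cases h4 : 1 - q - a + b < q ^ 2
  · refine Or.inr (Or.inr ⟨_, List.mem_cons_of_mem _ List.mem_cons_self, (1 - q - a) / q ^ 2,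
      b / q ^ 2, div_nonneg (by linarith) hq2.le, by positivity, ?_, ?_⟩)
    · rw [← add_div, div_le_one hq2]; linarith
    · simp only [smul_neg, smul_smul, div_mul_cancel₀ _ hq2.ne']; module
  by_cases h5 : a + (1 - q - b) < q ^ 2
  · refine Or.inr (Or.inr ⟨_, List.mem_cons_of_mem _ (List.mem_cons_of_mem _ List.mem_cons_self),
      a / q ^ 2, (1 - q - b) / q ^ 2, by positivity, div_nonneg (by linarith) hq2.le, ?_, ?_⟩)
    · rw [← add_div, div_le_one hq2]; linarith
    · simp only [smul_neg, smul_smul, div_mul_cancel₀ _ hq2.ne']; module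
  push Not at h3 h4 h5
  -- The corners cut from the square of side `1 - q` have legs exactly `q ^ 2`. The next identity
  -- says that the side opposite to the right angle lies on the hypotenuse `a + b = 1`.
  have hc : cut * (1 - q) = q ^ 2 := by rw [cut_eq]; linarith
  have hc2 : (2 - cut) * (1 - q) = 1 := by rw [sub_mul, hc]; linarith
  have key : ∀ t : ℝ, q ^ 2 ≤ t → cut ≤ t / (1 - q) := fun t ht => by
    rw [le_div_iff₀ hq1, hc]; exact ht
  refine Or.inl ⟨a / (1 - q), b / (1 - q), by positivity, ?_, by positivity, ?_, ?_, ?_, ?_, ?_, ?_⟩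
  · rw [div_le_one hq1]; exact ha1.le
  · rw [div_le_one hq1]; exact hb1.le
  · rw [← add_div]; exact key _ h3
  · refine (key _ h4).trans_eq ?_; field_simp
  · refine (key _ h5).trans_eq ?_; field_simp
  · have : (a + b) / (1 - q) ≤ 2 - cut := by rw [div_le_iff₀ hq1, hc2]; exact hab
    rw [add_div] at this; linarith
  · simp only [Triangle.octagon, smul_smul, div_mul_cancel₀ _ hq1.ne']

/-! ### The recursive subdivision -/

/-- Truncated subtraction merges the last two cases of the definition: with one step left, the
smaller triangles are already final, as `k - 1 = 0` says. -/
lemma Triangle.finalTriangles_succ (k : ℕ) (T : Triangle) :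
    T.finalTriangles (k + 1) = T.big.flatMap (Triangle.finalTriangles k) ++
      T.small.flatMap (Triangle.finalTriangles (k - 1)) := by
  cases k with
  | zero => simp [Triangle.finalTriangles, Triangle.big, Triangle.small]
  | succ k => simp [Triangle.finalTriangles]

lemma Triangle.octagons_succ (k : ℕ) (T : Triangle) :
    T.octagons (k + 1) = T.octagon :: (T.big.flatMap (Triangle.octagons k) ++
      T.small.flatMap (Triangle.octagons (k - 1))) := by
  cases k with
  | zero => simp [Triangle.octagons, Triangle.big, Triangle.small]
  | succ k => simp [Triangle.octagons]

lemma q_mul_grow_pow_succ (μ : ℝ) (k : ℕ) : q * (μ * grow ^ (k + 1)) = μ * grow ^ k := by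
  rw [pow_succ]; linear_combination (μ * grow ^ k) * q_mul_grow

lemma one_le_grow : 1 ≤ grow := by rw [grow_eq]; linarith [q_pos]

/-- An equality except for `k = 0`, where the smaller triangles overshoot the last leg and the
truncated exponent leaves slack. -/
lemma q_sq_mul_grow_pow_succ_le {μ : ℝ} (hμ : 0 ≤ μ) (k : ℕ) :
    q ^ 2 * (μ * grow ^ (k + 1)) ≤ μ * grow ^ (k - 1) := by
  rw [pow_two, mul_assoc, q_mul_grow_pow_succ]
  cases k with
  | zero => simp; nlinarith [q_lt, q_pos]
  | succ k => rw [q_mul_grow_pow_succ, Nat.add_sub_cancel]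

lemma Triangle.Good.big' {A : Set Plane} (hA : Convex ℝ A) {μ : ℝ} {k : ℕ} {T T' : Triangle}
    (h : T.Good A (μ * grow ^ (k + 1))) (hT' : T' ∈ T.big) : T'.Good A (μ * grow ^ k) :=
  q_mul_grow_pow_succ μ k ▸ h.big hA hT'

lemma Triangle.Good.small' {A : Set Plane} (hA : Convex ℝ A) {μ : ℝ} (hμ : 0 ≤ μ) {k : ℕ}
    {T T' : Triangle} (h : T.Good A (μ * grow ^ (k + 1))) (hT' : T' ∈ T.small) :
    T'.Good A (μ * grow ^ (k - 1)) :=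
  (h.small hA hT').mono (q_sq_mul_grow_pow_succ_le hμ k)

/-- Induction along the recursive subdivision. -/
lemma Triangle.Good.induction {A : Set Plane} (hA : Convex ℝ A) {μ : ℝ} (hμ : 0 ≤ μ)
    {P : ℕ → Triangle → Prop} (zero : ∀ T, T.Good A μ → P 0 T)
    (succ : ∀ k T, T.Good A (μ * grow ^ (k + 1)) → (∀ T' ∈ T.big, P k T') →
      (∀ T' ∈ T.small, P (k - 1) T') → P (k + 1) T)
    (k : ℕ) (T : Triangle) (h : T.Good A (μ * grow ^ k)) : P k T := by
  induction k using Nat.strong_induction_on generalizing T with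
  | _ k ih =>
    cases k with
    | zero => exact zero T (by simpa using h)
    | succ k =>
      exact succ k T h (fun T' hT' => ih k (by omega) T' (h.big' hA hT'))
        (fun T' hT' => ih (k - 1) (by omega) T' (h.small' hA hμ hT'))

lemma Triangle.Good.of_mem_finalTriangles {A : Set Plane} (hA : Convex ℝ A) {μ : ℝ} (hμ : 0 ≤ μ)
    {k : ℕ} {T : Triangle} (h : T.Good A (μ * grow ^ k)) :
    ∀ T' ∈ T.finalTriangles k, T'.Good A μ := by
  refine Triangle.Good.induction hA hμ (P := fun k T => ∀ T' ∈ T.finalTriangles k, T'.Good A μ)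
    ?_ ?_ k T h
  · intro T hT T' hT'
    rw [Triangle.finalTriangles, List.mem_singleton] at hT'
    exact hT' ▸ hT
  · intro k T _ h1 h2 T' hT'
    rw [Triangle.finalTriangles_succ] at hT'
    simp only [List.mem_append, List.mem_flatMap] at hT'
    rcases hT' with ⟨T₁, hT₁, hT'⟩ | ⟨T₁, hT₁, hT'⟩
    · exact h1 _ hT₁ _ hT'
    · exact h2 _ hT₁ _ hT'

lemma Triangle.Good.of_mem_octagons {A : Set Plane} (hA : Convex ℝ A) {μ : ℝ} (hμ : 0 ≤ μ)
    {k : ℕ} {T : Triangle} (h : T.Good A (μ * grow ^ k)) :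
    ∀ Q ∈ T.octagons k, Q.Regular ∧ Q.center ∈ A := by
  refine Triangle.Good.induction hA hμ
    (P := fun k T => ∀ Q ∈ T.octagons k, Q.Regular ∧ Q.center ∈ A) ?_ ?_ k T h
  · intro T hT Q hQ
    simp [Triangle.octagons] at hQ
  · intro k T hT h1 h2 Q hQ
    rw [Triangle.octagons_succ] at hQ
    simp only [List.mem_cons, List.mem_append, List.mem_flatMap] at hQ
    rcases hQ with rfl | ⟨T₁, hT₁, hQ⟩ | ⟨T₁, hT₁, hQ⟩
    · exact ⟨hT.regular, hT.octagon_center_mem hA⟩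
    · exact h1 _ hT₁ _ hQ
    · exact h2 _ hT₁ _ hQ

lemma Triangle.exists_mem_of_mem_region (k : ℕ) (T : Triangle) {x : Plane} (hx : x ∈ T.region) :
    (∃ T' ∈ T.finalTriangles k, x ∈ T'.region) ∨ ∃ Q ∈ T.octagons k, x ∈ Q.region := by
  induction k using Nat.strong_induction_on generalizing T with
  | _ k ih =>
    cases k with
    | zero => exact Or.inl ⟨T, by simp [Triangle.finalTriangles], hx⟩
    | succ k =>
      rw [Triangle.finalTriangles_succ, Triangle.octagons_succ]
      simp only [List.mem_cons, List.mem_append, List.mem_flatMap]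
      rcases T.region_subset hx with h | ⟨T', hT', h⟩ | ⟨T', hT', h⟩
      · exact Or.inr ⟨_, Or.inl rfl, h⟩
      · rcases ih k (by omega) T' h with ⟨T₁, h1, h2⟩ | ⟨Q, h1, h2⟩
        · exact Or.inl ⟨T₁, Or.inl ⟨T', hT', h1⟩, h2⟩
        · exact Or.inr ⟨Q, Or.inr (Or.inl ⟨T', hT', h1⟩), h2⟩
      · rcases ih (k - 1) (by omega) T' h with ⟨T₁, h1, h2⟩ | ⟨Q, h1, h2⟩
        · exact Or.inl ⟨T₁, Or.inr ⟨T', hT', h1⟩, h2⟩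
        · exact Or.inr ⟨Q, Or.inr (Or.inr ⟨T', hT', h1⟩), h2⟩

/-! ### Sums over the subdivision -/

/-- A solution of the recursive inequality `g (k + 1) ≥ grow ^ (k + 1) + 2 * g k + 3 * g (k - 1)`
that governs all counts in the subdivision. -/
noncomputable def countBound (k : ℕ) : ℝ :=
  if k = 0 then 1 else 10 * 3 ^ k - grow ^ 2 / 2 * grow ^ k

lemma grow_sq : grow ^ 2 = 2 * grow + 1 := by rw [grow_eq]; nlinarith [q_sq]

lemma grow_lt : grow < 2.4143 := by rw [grow_eq]; linarith [q_lt]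

lemma one_le_countBound_zero : 1 ≤ countBound 0 := by simp [countBound]

lemma countBound_le_sub (k : ℕ) : countBound k ≤ 10 * 3 ^ k - grow ^ 2 / 2 * grow ^ k := by
  have := grow_lt
  unfold countBound
  split_ifs with h
  · rw [h, pow_zero, pow_zero, grow_sq]; linarith
  · exact le_rfl

/-- The recursion has the homogeneous solution `3 ^ k`, and its particular solution is `-(grow ^ 2 /
2) * grow ^ k` because `grow ^ 2 - 2 * grow - 3 = -2`. At `0` the closed form would be too large for
the step from `0` to `1`, where both children terms are `countBound 0`; the value 1 there makes that
step work. -/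
lemma countBound_succ (k : ℕ) :
    grow ^ (k + 1) + 2 * countBound k + 3 * countBound (k - 1) ≤ countBound (k + 1) := by
  have h1 := grow_lt
  have h2 := one_le_grow
  cases k with
  | zero =>
    simp only [countBound, zero_add, zero_tsub, pow_one, grow_sq, if_true, if_neg one_ne_zero]
    nlinarith [grow_sq]
  | succ k =>
    have h3 := countBound_le_sub (k + 1)
    have h5 := countBound_le_sub k
    have h4 : grow ^ (k + 1 + 1) = (2 * grow + 1) * grow ^ k := by rw [← grow_sq]; ring
    have h6 : countBound (k + 1 + 1)
        = 10 * 3 ^ (k + 1 + 1) - grow ^ 2 / 2 * grow ^ (k + 1 + 1) := by simp [countBound]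
    rw [Nat.add_sub_cancel, h6, h4]
    rw [grow_sq] at h3 h5 ⊢
    ring_nf at h3 h5 ⊢
    linarith

lemma countBound_nonneg (k : ℕ) : 0 ≤ countBound k := by
  induction k using Nat.strong_induction_on with
  | _ k ih =>
    cases k with
    | zero => linarith [one_le_countBound_zero]
    | succ k =>
      have := countBound_succ k
      have := ih k (by omega)
      have := ih (k - 1) (by omega)
      have := pow_pos grow_pos (k + 1)
      linarith

lemma countBound_le (k : ℕ) : countBound k ≤ 10 * 3 ^ k := by
  have := grow_pos
  have : 0 ≤ grow ^ 2 / 2 * grow ^ k := by positivity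
  linarith [countBound_le_sub k]

lemma sum_flatMap_le {α β : Type*} {L : List α} {f : α → List β} {w : β → ℝ} {b : ℝ}
    (h : ∀ a ∈ L, ((f a).map w).sum ≤ b) : ((L.flatMap f).map w).sum ≤ L.length * b := by
  induction L with
  | nil => simp
  | cons a L ih =>
    have h1 := h a List.mem_cons_self
    have h2 := ih fun a' ha' => h a' (List.mem_cons_of_mem _ ha')
    simp only [List.flatMap_cons, List.map_append, List.sum_append, List.length_cons]
    push_cast
    linarith

/-- Meant for weights linear in the size of the octagon, such as the cross terms that arise when an
enlarged radius is squared. -/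
lemma Triangle.Good.sum_octagons_le {A : Set Plane} (hA : Convex ℝ A) {μ β : ℝ} (hμ : 0 ≤ μ)
    (hβ : 0 ≤ β) {w : Octagon → ℝ}
    (hw : ∀ (k : ℕ) (T : Triangle), T.Good A (μ * grow ^ k) → w T.octagon ≤ β * grow ^ k)
    {k : ℕ} {T : Triangle} (h : T.Good A (μ * grow ^ k)) :
    ((T.octagons k).map w).sum ≤ β * countBound k := by
  refine Triangle.Good.induction hA hμ
    (P := fun k T => ((T.octagons k).map w).sum ≤ β * countBound k) ?_ ?_ k T h
  · intro T _
    simpa [Triangle.octagons] using mul_nonneg hβ (countBound_nonneg 0)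
  · intro k T hT h1 h2
    rw [Triangle.octagons_succ]
    simp only [List.map_cons, List.sum_cons, List.map_append, List.sum_append]
    have e1 := sum_flatMap_le h1
    have e2 := sum_flatMap_le h2
    have e3 := hw _ _ hT
    have e4 := mul_le_mul_of_nonneg_left (countBound_succ k) hβ
    simp only [Triangle.big, Triangle.small, List.length_cons, List.length_nil] at e1 e2 ⊢
    push_cast at e1 e2
    linarith

lemma Triangle.Good.length_finalTriangles_le {A : Set Plane} (hA : Convex ℝ A) {μ : ℝ}
    (hμ : 0 ≤ μ) {k : ℕ} {T : Triangle} (h : T.Good A (μ * grow ^ k)) :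
    ((T.finalTriangles k).length : ℝ) ≤ countBound k := by
  suffices ((T.finalTriangles k).map fun _ => (1 : ℝ)).sum ≤ countBound k by simpa using this
  refine Triangle.Good.induction hA hμ
    (P := fun k T => ((T.finalTriangles k).map fun _ => (1 : ℝ)).sum ≤ countBound k) ?_ ?_ k T h
  · intro T _
    simpa [Triangle.finalTriangles] using one_le_countBound_zero
  · intro k T hT h1 h2
    rw [Triangle.finalTriangles_succ]
    rw [List.map_append, List.sum_append]
    have e1 := sum_flatMap_le h1
    have e2 := sum_flatMap_le h2
    have e4 := countBound_succ k
    have e5 := pow_pos grow_pos (k + 1)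
    simp only [Triangle.big, Triangle.small, List.length_cons, List.length_nil] at e1 e2 ⊢
    push_cast at e1 e2
    linarith

/-- The bound is the area of the triangle over `2√2`, and one subdivision step preserves it exactly:
`(1 - 2 q² - 3 q⁴) + 2 q² + 3 q⁴ = 1`. The only loss is in the final triangles, which contribute
nothing. -/
lemma Triangle.Good.sum_radius_sq_le {A : Set Plane} (hA : Convex ℝ A) {μ : ℝ} (hμ : 0 ≤ μ)
    {k : ℕ} {T : Triangle} (h : T.Good A (μ * grow ^ k)) :
    ((T.octagons k).map fun Q => Q.radius ^ 2).sum ≤ (1 + q) / 8 * ‖T.u‖ ^ 2 := by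
  have h0 := q_pos
  refine Triangle.Good.induction hA hμ
    (P := fun k T => ((T.octagons k).map fun Q => Q.radius ^ 2).sum ≤ (1 + q) / 8 * ‖T.u‖ ^ 2)
    ?_ ?_ k T h
  · intro T _
    simp only [Triangle.octagons, List.map_nil, List.sum_nil]
    positivity
  · intro k T hT h1 h2
    rw [Triangle.octagons_succ]
    simp only [List.map_cons, List.sum_cons, List.map_append, List.sum_append]
    have e1 := sum_flatMap_le (b := (1 + q) / 8 * (q ^ 2 * ‖T.u‖ ^ 2)) (fun T' hT' => by
      refine (h1 T' hT').trans_eq ?_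
      simp only [Triangle.big, List.mem_cons, List.not_mem_nil, or_false] at hT'
      rcases hT' with rfl | rfl <;> simp [norm_smul, mul_pow])
    have e2 := sum_flatMap_le (b := (1 + q) / 8 * (q ^ 4 * ‖T.u‖ ^ 2)) (fun T' hT' => by
      refine (h2 T' hT').trans_eq ?_
      simp only [Triangle.small, List.mem_cons, List.not_mem_nil, or_false] at hT'
      rcases hT' with rfl | rfl | rfl <;> simp [norm_smul, mul_pow, ← pow_mul])
    rw [hT.octagon_radius_sq]
    simp only [Triangle.big, Triangle.small, List.length_cons, List.length_nil] at e1 e2 ⊢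
    push_cast at e1 e2
    linarith

/-! ### The square -/

/-- The square `[0, m] × [0, m]`. -/
def square (m : ℕ) : Set Plane := {x | ∀ i, 0 ≤ x i ∧ x i ≤ m}

lemma convex_square (m : ℕ) : Convex ℝ (square m) := by
  intro x hx y hy a b ha hb hab i
  have h1 := hx i
  have h2 := hy i
  simp only [PiLp.add_apply, PiLp.smul_apply, smul_eq_mul]
  constructor
  · nlinarith
  · calc a * x i + b * y i ≤ a * m + b * m := by gcongr <;> linarith
      _ = m := by rw [← add_mul, hab, one_mul]

lemma mem_square {m : ℕ} {x : Plane} :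
    x ∈ square m ↔ (0 ≤ x 0 ∧ x 0 ≤ m) ∧ 0 ≤ x 1 ∧ x 1 ≤ m := by
  simp [square, Fin.forall_fin_two]

lemma dist_plane (x y : Plane) : dist x y = √((x 0 - y 0) ^ 2 + (x 1 - y 1) ^ 2) := by
  rw [EuclideanSpace.dist_eq, Fin.sum_univ_two, Real.dist_eq, Real.dist_eq, sq_abs, sq_abs]

lemma dist_le_of_mem_square {m : ℕ} {x y : Plane} (hx : x ∈ square m) (hy : y ∈ square m) :
    dist x y ≤ 2 * m := by
  rw [mem_square] at hx hy
  rw [dist_plane]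
  refine Real.sqrt_le_iff.2 ⟨by positivity, ?_⟩
  have h1 : (x 0 - y 0) ^ 2 ≤ (m : ℝ) ^ 2 :=
    sq_le_sq.2 (by rw [Nat.abs_cast, abs_le]; constructor <;> linarith)
  have h2 : (x 1 - y 1) ^ 2 ≤ (m : ℝ) ^ 2 :=
    sq_le_sq.2 (by rw [Nat.abs_cast, abs_le]; constructor <;> linarith)
  nlinarith

lemma pos_mem_square {m : ℕ} (v : Grid m) : pos v ∈ square m := by
  have h1 : ((v.1 : ℕ) : ℝ) + 1 ≤ m := by exact_mod_cast v.1.2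
  have h2 : ((v.2 : ℕ) : ℝ) + 1 ≤ m := by exact_mod_cast v.2.2
  rw [mem_square]
  simp only [pos, PiLp.toLp_apply, Matrix.cons_val_zero, Matrix.cons_val_one]
  refine ⟨⟨by positivity, by linarith⟩, by positivity, by linarith⟩

lemma cut_pos : 0 < cut := by rw [cut_eq]; linarith [q_lt]

lemma cut_lt : cut < 1 / 2 := by rw [cut_eq]; linarith [q_pos]

lemma corners_norm {m : ℕ} {T : Triangle} (hT : T ∈ corners m) : ‖T.u‖ = cut * m := by
  have hc := cut_pos
  have : 0 ≤ cut * m := by positivity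
  simp only [corners, List.mem_cons, List.not_mem_nil, or_false] at hT
  rcases hT with rfl | rfl | rfl | rfl <;>
    simp only [EuclideanSpace.norm_eq, Fin.sum_univ_two, Matrix.cons_val_zero,
      Matrix.cons_val_one, Real.norm_eq_abs, sq_abs] <;>
    rw [Real.sqrt_eq_iff_mul_self_eq (by positivity) this] <;> ring

lemma corners_good {m : ℕ} {T : Triangle} (hT : T ∈ corners m) :
    T.Good (square m) (cut * m) := by
  have hc := cut_pos
  have hc2 := cut_lt
  have h0 : 0 ≤ cut * m := by positivity
  have hm : cut * m ≤ m := by nlinarith [Nat.cast_nonneg (α := ℝ) m]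
  have hn := corners_norm hT
  refine ⟨?_, ?_, hn.le, ?_, ?_, ?_⟩
  rotate_left
  · rw [hn]
    simp only [corners, List.mem_cons, List.not_mem_nil, or_false] at hT
    rcases hT with rfl | rfl | rfl | rfl <;>
      simp only [EuclideanSpace.norm_eq, Fin.sum_univ_two, Matrix.cons_val_zero,
        Matrix.cons_val_one, Real.norm_eq_abs, sq_abs] <;>
      rw [Real.sqrt_eq_iff_mul_self_eq (by positivity) h0] <;> ring
  all_goals
    simp only [corners, List.mem_cons, List.not_mem_nil, or_false] at hT
    rcases hT with rfl | rfl | rfl | rfl <;>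
      simp [mem_square, PiLp.inner_apply, h0, hm]

lemma firstOctagon_norm (m : ℕ) : ‖(firstOctagon m).U‖ = m := by
  simp [firstOctagon, EuclideanSpace.norm_eq, Fin.sum_univ_two]

lemma firstOctagon_regular (m : ℕ) : (firstOctagon m).Regular := by
  constructor <;>
    simp [firstOctagon, EuclideanSpace.norm_eq, Fin.sum_univ_two, PiLp.inner_apply]

lemma firstOctagon_center_mem (m : ℕ) : (firstOctagon m).center ∈ square m := by
  have : (0 : ℝ) ≤ m := by positivity
  rw [mem_square]
  simp [firstOctagon, Octagon.center]
  linarith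

lemma firstOctagon_radius_le (m : ℕ) : (firstOctagon m).radius ≤ m := by
  refine abs_le_of_sq_le_sq' ?_ (by positivity) |>.2
  rw [(firstOctagon_regular m).radius_sq, firstOctagon_norm]
  refine mul_le_of_le_one_left (by positivity) ?_
  nlinarith [cut_pos, cut_lt]

lemma square_subset {m : ℕ} {x : Plane} (hx : x ∈ square m) :
    x ∈ (firstOctagon m).region ∨ ∃ T ∈ corners m, x ∈ T.region := by
  rw [mem_square] at hx
  obtain ⟨⟨h1, h2⟩, h3, h4⟩ := hx
  have hc := cut_pos
  -- For `m = 0` the square is a point and the divisions below would be by zero.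
  rcases (Nat.cast_nonneg (α := ℝ) m).eq_or_lt with hm | hm
  · rw [← hm] at h2 h4
    have e0 : x 0 = 0 := le_antisymm h2 h1
    have e1 : x 1 = 0 := le_antisymm h4 h3
    refine Or.inr ⟨_, List.mem_cons_self, 0, 0, le_rfl, le_rfl, by norm_num, ?_⟩
    ext i; fin_cases i <;> simp [e0, e1]
  have hl : 0 < cut * m := by positivity
  have hl' := hl.ne'
  by_cases c1 : x 0 + x 1 < cut * m
  · refine Or.inr ⟨_, List.mem_cons_self, x 0 / (cut * m), x 1 / (cut * m), by positivity,
      by positivity, ?_, ?_⟩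
    · rw [← add_div, div_le_one hl]; exact c1.le
    · ext i; fin_cases i <;> simp [div_mul_cancel₀ _ hl']
  by_cases c2 : m - x 0 + x 1 < cut * m
  · refine Or.inr ⟨_, List.mem_cons_of_mem _ List.mem_cons_self, (m - x 0) / (cut * m),
      x 1 / (cut * m), div_nonneg (by linarith) hl.le, by positivity, ?_, ?_⟩
    · rw [← add_div, div_le_one hl]; exact c2.le
    · ext i; fin_cases i <;> simp [div_mul_cancel₀ _ hl']
  by_cases c3 : x 0 + (m - x 1) < cut * m
  · refine Or.inr ⟨_, List.mem_cons_of_mem _ (List.mem_cons_of_mem _ List.mem_cons_self),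
      x 0 / (cut * m), (m - x 1) / (cut * m), by positivity, div_nonneg (by linarith) hl.le, ?_, ?_⟩
    · rw [← add_div, div_le_one hl]; exact c3.le
    · ext i; fin_cases i <;> simp [div_mul_cancel₀ _ hl']
  by_cases c4 : m - x 0 + (m - x 1) < cut * m
  · refine Or.inr ⟨_, List.mem_cons_of_mem _ (List.mem_cons_of_mem _ (List.mem_cons_of_mem _
      List.mem_cons_self)), (m - x 0) / (cut * m), (m - x 1) / (cut * m),
      div_nonneg (by linarith) hl.le, div_nonneg (by linarith) hl.le, ?_, ?_⟩
    · rw [← add_div, div_le_one hl]; exact c4.le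
    · ext i; fin_cases i <;> simp [div_mul_cancel₀ _ hl']
  push Not at c1 c2 c3 c4
  refine Or.inl ⟨x 0 / m, x 1 / m, by positivity, ?_, by positivity, ?_, ?_, ?_, ?_, ?_, ?_⟩
  · rwa [div_le_one hm]
  · rwa [div_le_one hm]
  · rwa [← add_div, le_div_iff₀ hm]
  · rw [← le_div_iff₀ hm] at c2
    refine c2.trans_eq ?_; field_simp
  · rw [← le_div_iff₀ hm] at c3
    refine c3.trans_eq ?_; field_simp
  · rw [← le_div_iff₀ hm] at c4
    refine c4.trans_eq ?_; field_simp
  · ext i; fin_cases i <;> simp [firstOctagon, div_mul_cancel₀ _ hm.ne']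

/-! ### The tiling -/

/-- The leg of the smallest triangles, up to one step of the subdivision. -/
noncomputable def lastLeg (m : ℕ) (c : ℝ) : ℝ := cut * m * q ^ depth m c

lemma lastLeg_nonneg (m : ℕ) (c : ℝ) : 0 ≤ lastLeg m c := by
  have := cut_pos
  have := q_pos
  unfold lastLeg; positivity

lemma lastLeg_mul (m : ℕ) (c : ℝ) : lastLeg m c * grow ^ depth m c = cut * m := by
  rw [lastLeg, mul_assoc, ← mul_pow, q_mul_grow, one_pow, mul_one]

lemma lastLeg_lt {m : ℕ} {c : ℝ} (h : 0 < c * sqrtLog m) : lastLeg m c < c * sqrtLog m := by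
  have hq : q < 1 := by linarith [q_lt]
  have ht : Filter.Tendsto (fun k : ℕ => cut * m * q ^ k) Filter.atTop (nhds 0) := by
    simpa using (tendsto_pow_atTop_nhds_zero_of_lt_one q_pos.le hq).const_mul (cut * (m : ℝ))
  exact Nat.sInf_mem (s := {k : ℕ | cut * m * q ^ k < c * sqrtLog m}) (ht.eventually_lt_const h).exists

/-- By minimality of the depth, one step earlier the leg was still at least `c * sqrtLog m`, hence
at least `c`. -/
lemma grow_pow_depth_le {m : ℕ} {c : ℝ} (hc : 0 < c) (hm : 1 ≤ sqrtLog m)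
    (hd : depth m c ≠ 0) : grow ^ depth m c ≤ grow / c * m := by
  obtain ⟨k, hk⟩ := Nat.exists_eq_succ_of_ne_zero hd
  have h1 : c * sqrtLog m ≤ cut * m * q ^ k := by
    by_contra! h
    have : depth m c ≤ k := Nat.sInf_le h
    omega
  have hg := grow_pos
  have h2 : c * grow ^ k ≤ m := by
    calc c * grow ^ k ≤ (c * sqrtLog m) * grow ^ k := by gcongr; nlinarith
      _ ≤ cut * m * q ^ k * grow ^ k := by gcongr
      _ = cut * m := by rw [mul_assoc, ← mul_pow, q_mul_grow, one_pow, mul_one]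
      _ ≤ 1 * m := by gcongr; linarith [cut_lt]
      _ = m := one_mul _
  rw [hk, Nat.succ_eq_add_one, pow_succ, div_mul_eq_mul_div, le_div_iff₀ hc]
  nlinarith

/-- The true exponent is `log 3 / log (1 + √2) ≈ 1.2465`. For `5/4` the claim is `81 ≤ grow ^ 5`,
and `grow ^ 5 = 29 * grow + 12` is about 82.01. -/
lemma three_le_grow_rpow : (3 : ℝ) ≤ grow ^ (5 / 4 : ℝ) := by
  have hg := grow_pos
  have h4 : (grow ^ (5 / 4 : ℝ)) ^ 4 = grow ^ 5 := by
    rw [← Real.rpow_natCast, ← Real.rpow_mul hg.le, ← Real.rpow_natCast]; norm_num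
  refine le_of_pow_le_pow_left₀ (n := 4) (by norm_num) (by positivity) ?_
  rw [h4]
  have : grow ^ 5 = 29 * grow + 12 := by
    have := grow_sq
    have h3 : grow ^ 3 = 5 * grow + 2 := by rw [pow_succ, this]; linear_combination 2 * this
    have : grow ^ 5 = grow ^ 3 * grow ^ 2 := by ring
    rw [this, h3, grow_sq]; linear_combination 10 * grow_sq
  rw [this, grow_eq]
  linarith [q_gt]

/-- The factor in the bound for `3 ^ depth`. -/
noncomputable def depthFactor (c : ℝ) : ℝ := (grow / c) ^ (5 / 4 : ℝ) + 1

lemma depthFactor_pos {c : ℝ} (hc : 0 < c) : 0 < depthFactor c := by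
  have := grow_pos
  unfold depthFactor; positivity

lemma three_pow_depth_le {m : ℕ} {c : ℝ} (hc : 0 < c) (hm : 1 ≤ sqrtLog m) (hm1 : 1 ≤ m) :
    (3 : ℝ) ^ depth m c ≤ depthFactor c * (m : ℝ) ^ (5 / 4 : ℝ) := by
  have hg := grow_pos
  have hm2 : (1 : ℝ) ≤ m := by exact_mod_cast hm1
  have h1 : (1 : ℝ) ≤ (m : ℝ) ^ (5 / 4 : ℝ) := Real.one_le_rpow hm2 (by norm_num)
  have h2 : 0 ≤ (grow / c) ^ (5 / 4 : ℝ) := by positivity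
  unfold depthFactor
  -- Without a previous step minimality says nothing; the summand 1 in `depthFactor` serves this
  -- case.
  by_cases hd : depth m c = 0
  · rw [hd, pow_zero]; nlinarith
  calc (3 : ℝ) ^ depth m c ≤ (grow ^ (5 / 4 : ℝ)) ^ depth m c :=
        pow_le_pow_left₀ (by norm_num) three_le_grow_rpow _
    _ = (grow ^ depth m c) ^ (5 / 4 : ℝ) := by
        rw [← Real.rpow_natCast, ← Real.rpow_mul hg.le, mul_comm, Real.rpow_mul hg.le,
          Real.rpow_natCast]
    _ ≤ (grow / c * m) ^ (5 / 4 : ℝ) :=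
        Real.rpow_le_rpow (by positivity) (grow_pow_depth_le hc hm hd) (by norm_num)
    _ = (grow / c) ^ (5 / 4 : ℝ) * (m : ℝ) ^ (5 / 4 : ℝ) :=
        Real.mul_rpow (by positivity) (by positivity)
    _ ≤ _ := by nlinarith

lemma corners_good' {m : ℕ} (c : ℝ) {T : Triangle} (hT : T ∈ corners m) :
    T.Good (square m) (lastLeg m c * grow ^ depth m c) := by
  rw [lastLeg_mul]; exact corners_good hT

lemma good_of_mem_triangles {m : ℕ} {c : ℝ} {T : Triangle} (hT : T ∈ triangles m c) :
    T.Good (square m) (lastLeg m c) := by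
  obtain ⟨T₀, h0, h1⟩ := List.mem_flatMap.1 hT
  exact (corners_good' c h0).of_mem_finalTriangles (convex_square m) (lastLeg_nonneg m c) T h1

lemma regular_of_mem_octagons {m : ℕ} {c : ℝ} {Q : Octagon} (hQ : Q ∈ octagons m c) :
    Q.Regular ∧ Q.center ∈ square m := by
  rcases List.mem_cons.1 hQ with rfl | hQ
  · exact ⟨firstOctagon_regular m, firstOctagon_center_mem m⟩
  obtain ⟨T₀, h0, h1⟩ := List.mem_flatMap.1 hQ
  exact (corners_good' c h0).of_mem_octagons (convex_square m) (lastLeg_nonneg m c) Q h1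

lemma exists_tile {m : ℕ} (c : ℝ) {x : Plane} (hx : x ∈ square m) :
    (∃ T ∈ triangles m c, x ∈ T.region) ∨ ∃ Q ∈ octagons m c, x ∈ Q.region := by
  rcases square_subset hx with h | ⟨T, hT, h⟩
  · exact Or.inr ⟨_, List.mem_cons_self, h⟩
  rcases T.exists_mem_of_mem_region (depth m c) h with ⟨T', h1, h2⟩ | ⟨Q, h1, h2⟩
  · exact Or.inl ⟨T', List.mem_flatMap.2 ⟨T, hT, h1⟩, h2⟩
  · exact Or.inr ⟨Q, List.mem_cons_of_mem _ (List.mem_flatMap.2 ⟨T, hT, h1⟩), h2⟩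

lemma corners_length (m : ℕ) : (corners m).length = 4 := rfl

lemma length_triangles_le (m : ℕ) (c : ℝ) :
    ((triangles m c).length : ℝ) ≤ 40 * 3 ^ depth m c := by
  have := sum_flatMap_le (L := corners m) (f := Triangle.finalTriangles (depth m c))
    (w := fun _ => (1 : ℝ)) (b := 10 * 3 ^ depth m c) (fun T hT => by
      simpa using ((corners_good' c hT).length_finalTriangles_le (convex_square m)
        (lastLeg_nonneg m c)).trans (countBound_le _))
  rw [corners_length] at this
  simp only [List.map_const', List.sum_replicate, nsmul_eq_mul, mul_one] at this
  unfold triangles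
  push_cast at this
  linarith

/-- The right side is the area of the whole square over `2√2`: the first octagon and the four corner
triangles share it out. -/
lemma sum_octagons_radius_sq_le (m : ℕ) (c : ℝ) :
    ((octagons m c).map fun Q => Q.radius ^ 2).sum ≤ √2 / 4 * (m : ℝ) ^ 2 := by
  have := sum_flatMap_le (L := corners m) (f := Triangle.octagons (depth m c))
    (w := fun Q => Q.radius ^ 2) (b := (1 + q) / 8 * (cut * m) ^ 2) (fun T hT => by
      have := (corners_good' c hT).sum_radius_sq_le (convex_square m) (lastLeg_nonneg m c)
      rwa [corners_norm hT] at this)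
  rw [corners_length] at this
  rw [octagons, List.map_cons, List.sum_cons, (firstOctagon_regular m).radius_sq,
    firstOctagon_norm]
  refine (add_le_add_right this _).trans_eq ?_
  rw [sqrt_two_eq, cut_eq]
  push_cast
  have h3 : q ^ 3 = 5 * q - 2 := by nlinarith [q_sq]
  ring_nf
  rw [h3, q_sq]; ring

lemma sum_octagons_le {m : ℕ} {c β : ℝ} (hβ : 0 ≤ β) {w : Octagon → ℝ}
    (hw : ∀ (k : ℕ) (T : Triangle), T.Good (square m) (lastLeg m c * grow ^ k) →
      w T.octagon ≤ β * grow ^ k) :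
    ((octagons m c).map w).sum ≤ w (firstOctagon m) + 40 * β * 3 ^ depth m c := by
  have := sum_flatMap_le (L := corners m) (f := Triangle.octagons (depth m c))
    (w := w) (b := β * (10 * 3 ^ depth m c)) (fun T hT =>
      ((corners_good' c hT).sum_octagons_le (convex_square m) (lastLeg_nonneg m c) hβ hw).trans
        (mul_le_mul_of_nonneg_left (countBound_le _) hβ))
  rw [corners_length] at this
  rw [octagons, List.map_cons, List.sum_cons]
  push_cast at this
  linarith

/-! ### The cost of the covering -/

lemma sum_filterMap_le {α β γ : Type*} {L : List α} {o : α → Option β} {f : α → β → γ}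
    {w : γ → ℝ} {W : α → ℝ} (h0 : ∀ a, 0 ≤ W a) (h : ∀ a b, w (f a b) ≤ W a) :
    ((L.filterMap fun a => (o a).map (f a)).map w).sum ≤ (L.map W).sum := by
  induction L with
  | nil => simp
  | cons a L ih =>
    cases e : o a with
    | none =>
      rw [List.filterMap_cons_none (by simp [e]), List.map_cons, List.sum_cons]
      linarith [h0 a]
    | some b =>
      rw [List.filterMap_cons_some (b := f a b) (by simp [e])]
      simp only [List.map_cons, List.sum_cons]
      exact add_le_add (h a b) ih

/-- The factor of the lower order term of the cost of OCT. -/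
noncomputable def costFactor (c K : ℝ) : ℝ :=
  2 * K + K ^ 2 + (80 * c ^ 2 + 40 * (2 * K * c + K ^ 2)) * depthFactor c

lemma costFactor_nonneg {c K : ℝ} (hc : 0 < c) (hK : 0 < K) : 0 ≤ costFactor c K := by
  have := depthFactor_pos hc
  unfold costFactor; positivity

/-- Uniform in `σ`: every tile is charged as if it had selected a node. Squaring `r + K * sqrtLog m`
gives the area term plus terms that are linear in `r` or constant, and these are bounded by the `3 ^
depth` count. -/
lemma diskCost_disks_le {m : ℕ} {c K : ℝ} (hc : 0 < c) (hK : 0 < K) (hm : 1 ≤ sqrtLog m)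
    (hm1 : 1 ≤ m) (σ : Selection m) :
    diskCost (σ.disks c K) ≤
      √2 / 4 * (m : ℝ) ^ 2 + costFactor c K * (sqrtLog m ^ 2 * (m : ℝ) ^ (5 / 4 : ℝ)) := by
  have hlam : 0 < sqrtLog m := by linarith
  set lam := sqrtLog m with hlam_def
  have hm2 : (1 : ℝ) ≤ m := by exact_mod_cast hm1
  have hmm : (m : ℝ) ≤ (m : ℝ) ^ (5 / 4 : ℝ) := Real.self_le_rpow_of_one_le hm2 (by norm_num)
  have h3 := three_pow_depth_le hc hm hm1
  have hleg := lastLeg_lt (m := m) (c := c) (by positivity)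
  have htri : ((σ.triDisks c).map fun d => d.radius ^ 2).sum
      ≤ 80 * c ^ 2 * lam ^ 2 * 3 ^ depth m c := by
    have := sum_filterMap_le (L := triangles m c) (o := σ.tri)
      (f := fun _ v => (⟨v, √2 * c * lam⟩ : Disk m)) (w := fun d => d.radius ^ 2)
      (W := fun _ => 2 * c ^ 2 * lam ^ 2) (fun _ => by positivity)
      (fun _ _ => by simp only [mul_pow, Real.sq_sqrt (show (0 : ℝ) ≤ 2 by norm_num)]; rfl)
    refine this.trans ?_
    simp only [List.map_const', List.sum_replicate, nsmul_eq_mul]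
    calc _ ≤ (40 * 3 ^ depth m c) * (2 * c ^ 2 * lam ^ 2) := by
          gcongr; exact length_triangles_le m c
      _ = _ := by ring
  have hoct : ((σ.octDisks c K).map fun d => d.radius ^ 2).sum
      ≤ √2 / 4 * (m : ℝ) ^ 2 + (2 * K * lam * m + K ^ 2 * lam ^ 2
        + 40 * ((2 * K * c + K ^ 2) * lam ^ 2) * 3 ^ depth m c) := by
    have := sum_filterMap_le (L := octagons m c) (o := σ.oct)
      (f := octDisk K) (w := fun d => d.radius ^ 2)
      (W := fun Q => Q.radius ^ 2 + (2 * K * lam * Q.radius + K ^ 2 * lam ^ 2))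
      (fun Q => by have := Q.radius_nonneg; positivity)
      (fun _ _ => by simp only [octDisk]; exact le_of_eq (by ring))
    refine this.trans ?_
    rw [List.sum_map_add]
    refine add_le_add (sum_octagons_radius_sq_le m c) ?_
    refine (sum_octagons_le (β := (2 * K * c + K ^ 2) * lam ^ 2) (by positivity) ?_).trans ?_
    · intro k T hT
      have h5 : (1 : ℝ) ≤ grow ^ k := one_le_pow₀ one_le_grow
      have h6 : T.octagon.radius ≤ c * lam * grow ^ k :=
        hT.octagon_radius_le.trans (by gcongr)
      calc 2 * K * lam * T.octagon.radius + K ^ 2 * lam ^ 2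
          ≤ 2 * K * lam * (c * lam * grow ^ k) + K ^ 2 * lam ^ 2 * grow ^ k := by
            have := le_mul_of_one_le_right (show 0 ≤ K ^ 2 * lam ^ 2 by positivity) h5
            gcongr
        _ = _ := by ring
    · have := firstOctagon_radius_le m
      gcongr
  rw [diskCost, Selection.disks, List.map_append, List.sum_append]
  have h7 : 2 * K * lam * m + K ^ 2 * lam ^ 2
      ≤ (2 * K + K ^ 2) * (lam ^ 2 * (m : ℝ) ^ (5 / 4 : ℝ)) := by
    have e1 : lam * m ≤ lam ^ 2 * (m : ℝ) ^ (5 / 4 : ℝ) := by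
      refine mul_le_mul ?_ hmm (by positivity) (by positivity)
      nlinarith
    have e2 : lam ^ 2 ≤ lam ^ 2 * (m : ℝ) ^ (5 / 4 : ℝ) :=
      le_mul_of_one_le_right (by positivity) (hm2.trans hmm)
    nlinarith [mul_le_mul_of_nonneg_left e1 hK.le, mul_le_mul_of_nonneg_left e2 (sq_nonneg K)]
  have h8 : (80 * c ^ 2 + 40 * (2 * K * c + K ^ 2)) * lam ^ 2 * 3 ^ depth m c ≤
      (80 * c ^ 2 + 40 * (2 * K * c + K ^ 2)) * lam ^ 2
        * (depthFactor c * (m : ℝ) ^ (5 / 4 : ℝ)) := by gcongr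
  unfold costFactor
  linarith

/-! ### Probabilities of random grid sets -/

section Probability

variable {m : ℕ} {p : Grid m → ℝ}

lemma setProb_nonneg (hp : ∀ i, 0 ≤ p i ∧ p i ≤ 1) (S : Finset (Grid m)) : 0 ≤ setProb p S :=
  mul_nonneg (Finset.prod_nonneg fun i _ => (hp i).1)
    (Finset.prod_nonneg fun i _ => sub_nonneg.2 (hp i).2)

lemma sum_prod_mul_prod_compl (f g : Grid m → ℝ) :
    ∑ S : Finset (Grid m), (∏ i ∈ S, f i) * ∏ i ∈ Sᶜ, g i = ∏ i, (f i + g i) := by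
  rw [Finset.prod_add, Finset.powerset_univ]
  simp only [Finset.compl_eq_univ_sdiff]

lemma sum_setProb : ∑ S : Finset (Grid m), setProb p S = 1 := by
  simp only [setProb]
  rw [sum_prod_mul_prod_compl]
  simp

open Classical in
lemma prob_not (E : Finset (Grid m) → Prop) : prob p (fun S => ¬ E S) = 1 - prob p E := by
  rw [← sum_setProb (p := p), prob, prob, eq_sub_iff_add_eq, add_comm,
    ← Finset.sum_filter_add_sum_filter_not Finset.univ E]
  congr!

lemma prob_mono (hp : ∀ i, 0 ≤ p i ∧ p i ≤ 1) {E F : Finset (Grid m) → Prop}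
    (h : ∀ S, E S → F S) : prob p E ≤ prob p F := by
  unfold prob
  refine Finset.sum_le_sum_of_subset_of_nonneg ?_ fun S _ _ => setProb_nonneg hp S
  intro S hS
  simp only [Finset.mem_filter, Finset.mem_univ, true_and] at hS ⊢
  exact h S hS

lemma prob_exists_le (hp : ∀ i, 0 ≤ p i ∧ p i ≤ 1) {ι : Type*} [Fintype ι]
    (E : ι → Finset (Grid m) → Prop) :
    prob p (fun S => ∃ i, E i S) ≤ ∑ i, prob p (E i) := by
  classical
  unfold prob
  simp only [Finset.sum_filter]
  rw [Finset.sum_comm]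
  refine Finset.sum_le_sum fun S _ => ?_
  have hn : ∀ i ∈ Finset.univ, 0 ≤ if E i S then setProb p S else 0 := fun i _ => by
    split_ifs
    exacts [setProb_nonneg hp S, le_rfl]
  split_ifs with h
  · obtain ⟨i, hi⟩ := h
    have := Finset.single_le_sum hn (Finset.mem_univ i)
    rwa [if_pos hi] at this
  · exact Finset.sum_nonneg hn

/-- Setting the selection weights on `A` to zero kills exactly the sets that meet `A`; the remaining
sum is the expansion of a product. -/
lemma prob_disjoint (A : Finset (Grid m)) :
    prob p (fun S => ∀ v ∈ S, v ∉ A) = ∏ i ∈ A, (1 - p i) := by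
  classical
  have h := sum_prod_mul_prod_compl (fun i => if i ∈ A then 0 else p i) fun i => 1 - p i
  have h2 : ∏ i, ((if i ∈ A then 0 else p i) + (1 - p i)) = ∏ i ∈ A, (1 - p i) := by
    rw [← Finset.prod_subset (Finset.subset_univ A)]
    · refine Finset.prod_congr rfl fun i hi => by simp [hi]
    · intro i _ hi; simp [hi]
  rw [h2] at h
  rw [← h, prob, Finset.sum_filter]
  refine Finset.sum_congr rfl fun S _ => ?_
  split_ifs with hS
  · rw [setProb]
    congr 1
    exact Finset.prod_congr rfl fun i hi => by simp [hS i hi]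
  · push Not at hS
    obtain ⟨v, hv, hA⟩ := hS
    rw [Finset.prod_eq_zero hv (by simp [hA]), zero_mul]

lemma prob_disjoint_le {pmin : ℝ} (hp : ∀ i, pmin ≤ p i ∧ p i ≤ 1) (A : Finset (Grid m)) :
    prob p (fun S => ∀ v ∈ S, v ∉ A) ≤ (1 - pmin) ^ A.card := by
  rw [prob_disjoint, ← Finset.prod_const]
  exact Finset.prod_le_prod (fun i _ => by linarith [hp i]) fun i _ => by linarith [hp i]

end Probability

/-! ### Every point of the square is close to a node -/

/-- An interval of `h + 1` numbers, of distance at most `h` from `a`, below `m`. -/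
def nearInterval {m : ℕ} (h : ℕ) (a : Fin m) : Finset (Fin m) :=
  Finset.univ.filter fun b => (a : ℕ) ≤ b + h ∧ (b : ℕ) ≤ a + h

lemma le_card_nearInterval {m h : ℕ} (hm : 2 * h + 1 ≤ m) (a : Fin m) :
    h + 1 ≤ (nearInterval h a).card := by
  -- A block of `h + 1` numbers starting at `a`, or ending at `a` if the first would stick out of
  -- the grid.
  have : ∃ s : ℕ, s + h < m ∧ (a : ℕ) ≤ s + h ∧ s ≤ a := by
    by_cases ha : (a : ℕ) + h < m
    · exact ⟨a, ha, by omega, le_rfl⟩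
    · exact ⟨a - h, by omega, by omega, by omega⟩
  obtain ⟨s, h1, h2, h3⟩ := this
  calc h + 1 = (Finset.univ : Finset (Fin (h + 1))).card := by simp
    _ ≤ _ := Finset.card_le_card_of_injOn (fun i : Fin (h + 1) => (⟨s + i, by omega⟩ : Fin m))
      (fun i _ => by simp [nearInterval]; omega)
      (fun i _ j _ hij => by simp at hij; exact Fin.ext hij)

lemma dist_pos_le {m h : ℕ} {g v : Grid m} (hv : v ∈ nearInterval h g.1 ×ˢ nearInterval h g.2) :
    dist (pos v) (pos g) ≤ 2 * h := by
  simp only [nearInterval, Finset.mem_product, Finset.mem_filter, Finset.mem_univ, true_and] at hv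
  obtain ⟨⟨h1, h2⟩, h3, h4⟩ := hv
  rw [← Nat.cast_le (α := ℝ)] at h1 h2 h3 h4
  push_cast at h1 h2 h3 h4
  rw [dist_plane]
  refine Real.sqrt_le_iff.2 ⟨by positivity, ?_⟩
  simp only [pos, PiLp.toLp_apply, Matrix.cons_val_zero, Matrix.cons_val_one]
  have e1 : (((v.1 : ℕ) : ℝ) + 1 / 2 - ((g.1 : ℕ) + 1 / 2)) ^ 2 ≤ (h : ℝ) ^ 2 :=
    sq_le_sq.2 (by rw [Nat.abs_cast, abs_le]; constructor <;> linarith)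
  have e2 : (((v.2 : ℕ) : ℝ) + 1 / 2 - ((g.2 : ℕ) + 1 / 2)) ^ 2 ≤ (h : ℝ) ^ 2 :=
    sq_le_sq.2 (by rw [Nat.abs_cast, abs_le]; constructor <;> linarith)
  nlinarith

/-- Every point of the square has distance at most `ρ` from a node. -/
def Dense (m : ℕ) (ρ : ℝ) (S : Finset (Grid m)) : Prop :=
  ∀ x ∈ square m, ∃ v ∈ S, dist (pos v) x ≤ ρ

lemma exists_fin_near {m : ℕ} (hm : 1 ≤ m) {t : ℝ} (h0 : 0 ≤ t) (h1 : t ≤ m) :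
    ∃ i : Fin m, ((i : ℕ) + 1 / 2 - t) ^ 2 ≤ (1 / 2 : ℝ) ^ 2 := by
  -- The cell containing `t` is found by rounding down, except at the right edge, where the floor is
  -- out of range.
  rcases h1.eq_or_lt with rfl | h1
  · refine ⟨⟨m - 1, by omega⟩, le_of_eq ?_⟩
    simp only [Nat.cast_pred (show 0 < m by omega)]; ring
  · have hf := Nat.floor_le h0
    have hf' := Nat.lt_floor_add_one t
    refine ⟨⟨⌊t⌋₊, (Nat.floor_lt h0).2 h1⟩, sq_le_sq.2 ?_⟩
    rw [abs_of_pos (show (0 : ℝ) < 1 / 2 by norm_num), abs_le]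
    constructor <;> simp only <;> linarith

lemma dense_of_forall_grid {m h : ℕ} (hm : 1 ≤ m) {S : Finset (Grid m)}
    (hS : ∀ g : Grid m, ∃ v ∈ S, v ∈ nearInterval h g.1 ×ˢ nearInterval h g.2) :
    Dense m (2 * h + 1) S := by
  intro x hx
  rw [mem_square] at hx
  obtain ⟨i, hi⟩ := exists_fin_near hm hx.1.1 hx.1.2
  obtain ⟨j, hj⟩ := exists_fin_near hm hx.2.1 hx.2.2
  obtain ⟨v, hv, hv'⟩ := hS (i, j)
  refine ⟨v, hv, (dist_triangle _ (pos (i, j)) _).trans (add_le_add (dist_pos_le hv') ?_)⟩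
  rw [dist_plane]
  refine Real.sqrt_le_iff.2 ⟨by positivity, ?_⟩
  simp only [pos, PiLp.toLp_apply, Matrix.cons_val_zero, Matrix.cons_val_one]
  linarith

/-- A union bound over the `m ^ 2` boxes around grid points, each of at least `(h + 1) ^ 2` points.
In the radius, `2 * h` bounds distances to the centre of a box and 1 the distance from a point of
the square to the grid. -/
lemma prob_dense_ge {m h : ℕ} (hm : 2 * h + 1 ≤ m) {pmin : ℝ} {p : Grid m → ℝ}
    (hpmin : 0 < pmin) (hp : ∀ i, pmin ≤ p i ∧ p i ≤ 1) :
    1 - (m : ℝ) ^ 2 * (1 - pmin) ^ ((h + 1) ^ 2) ≤ prob p (Dense m (2 * h + 1)) := by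
  have hp' : ∀ i, 0 ≤ p i ∧ p i ≤ 1 := fun i => ⟨hpmin.le.trans (hp i).1, (hp i).2⟩
  have hp1 : pmin ≤ 1 := (hp (⟨0, by omega⟩, ⟨0, by omega⟩)).1.trans (hp _).2
  have h1 := prob_exists_le hp' fun (g : Grid m) (S : Finset (Grid m)) =>
    ∀ v ∈ S, v ∉ nearInterval h g.1 ×ˢ nearInterval h g.2
  have h2 : ∑ g : Grid m, prob p (fun S : Finset (Grid m) =>
      ∀ v ∈ S, v ∉ nearInterval h g.1 ×ˢ nearInterval h g.2)
      ≤ (m : ℝ) ^ 2 * (1 - pmin) ^ ((h + 1) ^ 2) := by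
    refine (Finset.sum_le_card_nsmul _ _ ((1 - pmin) ^ ((h + 1) ^ 2)) fun g _ => ?_).trans_eq ?_
    · refine (prob_disjoint_le hp _).trans
        (pow_le_pow_of_le_one (by linarith) (by linarith) ?_)
      rw [Finset.card_product, pow_two]
      exact Nat.mul_le_mul (le_card_nearInterval hm _) (le_card_nearInterval hm _)
    · simp [pow_two]
  have h3 := prob_mono hp' (E := fun S => ¬ ∃ g : Grid m,
    ∀ v ∈ S, v ∉ nearInterval h g.1 ×ˢ nearInterval h g.2) (F := Dense m (2 * h + 1))
    fun S hS => dense_of_forall_grid (by omega) (by push Not at hS; exact hS)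
  rw [prob_not] at h3
  linarith

/-! ### Asymptotics -/

lemma tendsto_sqrtLog : Filter.Tendsto sqrtLog Filter.atTop Filter.atTop := by
  have h1 : Filter.Tendsto (fun m : ℕ => (m : ℝ) ^ 2) Filter.atTop Filter.atTop :=
    (Filter.tendsto_pow_atTop two_ne_zero).comp tendsto_natCast_atTop_atTop
  exact Real.tendsto_sqrt_atTop.comp (Real.tendsto_log_atTop.comp h1)

lemma sqrtLog_sq {m : ℕ} (hm : 1 ≤ m) : sqrtLog m ^ 2 = 2 * Real.log m := by
  have h : (1 : ℝ) ≤ m := by exact_mod_cast hm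
  rw [sqrtLog, Real.sq_sqrt (Real.log_nonneg (one_le_pow₀ h)), Real.log_pow]
  norm_num

/-- `0.63 * 2 = 1.26` exceeds `5/4` by `0.01`, which absorbs the logarithm. -/
lemma eventually_sqrtLog_sq_mul_le :
    ∀ᶠ m : ℕ in Filter.atTop,
      sqrtLog m ^ 2 * (m : ℝ) ^ (5 / 4 : ℝ) ≤ (((m ^ 2 : ℕ) : ℝ)) ^ (0.63 : ℝ) := by
  have h := ((isLittleO_log_rpow_atTop (show (0 : ℝ) < 0.01 by norm_num)).bound
    (show (0 : ℝ) < 1 / 2 by norm_num))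
  have h2 := tendsto_natCast_atTop_atTop (R := ℝ) |>.eventually h
  filter_upwards [h2, Filter.eventually_ge_atTop 1] with m hm hm1
  have h3 : (1 : ℝ) ≤ m := by exact_mod_cast hm1
  have h4 : (0 : ℝ) < m := by linarith
  rw [Real.norm_of_nonneg (Real.log_nonneg h3), Real.norm_of_nonneg (by positivity)] at hm
  rw [sqrtLog_sq hm1, Nat.cast_pow, ← Real.rpow_natCast, ← Real.rpow_mul h4.le]
  calc 2 * Real.log m * (m : ℝ) ^ (5 / 4 : ℝ)
      ≤ 2 * (1 / 2 * (m : ℝ) ^ (0.01 : ℝ)) * (m : ℝ) ^ (5 / 4 : ℝ) := by gcongr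
    _ = (m : ℝ) ^ (0.01 + 5 / 4 : ℝ) := by rw [Real.rpow_add h4]; ring
    _ = _ := by norm_num

lemma eventually_mul_sqrtLog_le (C : ℝ) : ∀ᶠ m : ℕ in Filter.atTop, C * sqrtLog m ≤ m := by
  have h := (isLittleO_log_rpow_atTop (show (0 : ℝ) < 1 by norm_num)).bound
    (show (0 : ℝ) < 1 / (2 * (C ^ 2 + 1)) by positivity)
  have h2 := tendsto_natCast_atTop_atTop (R := ℝ) |>.eventually h
  filter_upwards [h2, Filter.eventually_ge_atTop 1] with m hm hm1
  have h3 : (1 : ℝ) ≤ m := by exact_mod_cast hm1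
  rw [Real.norm_of_nonneg (Real.log_nonneg h3), Real.rpow_one,
    Real.norm_of_nonneg (by positivity)] at hm
  refine abs_le_of_sq_le_sq' ?_ (by positivity) |>.2
  rw [mul_pow, sqrtLog_sq hm1]
  have h5 : (C ^ 2 + 1) * (2 * Real.log m) ≤ m := by
    rw [div_mul_eq_mul_div, one_mul, le_div_iff₀ (by positivity)] at hm
    linarith
  nlinarith [Real.log_nonneg h3]

/-- With a suitable constant, all points of the square are close to nodes with probability at
least `1 - 1 / n`. -/
lemma exists_prob_dense {pmin : ℝ} (hpmin : 0 < pmin) (hpmin1 : pmin < 1) :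
    ∃ κ : ℝ, 0 < κ ∧ ∀ᶠ m : ℕ in Filter.atTop, ∀ p : Grid m → ℝ,
      (∀ i, pmin ≤ p i ∧ p i ≤ 1) →
      1 - 1 / (m : ℝ) ^ 2 ≤ prob p (Dense m (κ * sqrtLog m)) := by
  set L := -Real.log (1 - pmin) with hL
  have hLpos : 0 < L := by
    have := Real.log_neg (show 0 < 1 - pmin by linarith) (by linarith); linarith
  -- Chosen so that `(h + 1) ^ 2 * L ≥ 4 * log m`: a box is empty with probability at most `m ^
  -- (-4)`, and the `m ^ 2` boxes together cost `1 / m ^ 2`.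
  set τ := √(2 / L) with hτ
  have hτpos : 0 < τ := by positivity
  refine ⟨2 * τ + 1, by positivity, ?_⟩
  filter_upwards [eventually_mul_sqrtLog_le (2 * τ + 1), Filter.eventually_ge_atTop 1,
    tendsto_sqrtLog.eventually_ge_atTop 1] with m hm hm1 hlam p hp
  have h3 : (1 : ℝ) ≤ m := by exact_mod_cast hm1
  set h := ⌊τ * sqrtLog m⌋₊ with hh
  have hf : (h : ℝ) ≤ τ * sqrtLog m := Nat.floor_le (by positivity)
  have hf' : τ * sqrtLog m < h + 1 := Nat.lt_floor_add_one _
  have hle : (2 * h + 1 : ℝ) ≤ (2 * τ + 1) * sqrtLog m := by linarith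
  have hhm : 2 * h + 1 ≤ m := by
    have : (2 * h + 1 : ℝ) ≤ m := hle.trans hm
    exact_mod_cast this
  have h4 := prob_dense_ge hhm hpmin hp
  have h5 : (1 - pmin) ^ ((h + 1) ^ 2) ≤ 1 / (m : ℝ) ^ 4 := by
    rw [← Real.log_le_log_iff (pow_pos (by linarith) _) (by positivity), Real.log_pow, one_div,
      Real.log_inv, Real.log_pow]
    have h6 : τ ^ 2 * sqrtLog m ^ 2 ≤ ((h : ℝ) + 1) ^ 2 := by
      rw [← mul_pow]; exact pow_le_pow_left₀ (by positivity) hf'.le 2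
    rw [hτ, Real.sq_sqrt (by positivity), sqrtLog_sq hm1] at h6
    have h7 := mul_le_mul_of_nonneg_right h6 hLpos.le
    have h8 : 2 / L * (2 * Real.log m) * L = 4 * Real.log m := by field_simp; ring
    push_cast
    rw [h8] at h7
    have : Real.log (1 - pmin) = -L := by rw [hL]; ring
    rw [this]; linarith
  have h9 : (m : ℝ) ^ 2 * (1 - pmin) ^ ((h + 1) ^ 2) ≤ 1 / (m : ℝ) ^ 2 := by
    refine (mul_le_mul_of_nonneg_left h5 (by positivity)).trans_eq ?_
    field_simp
  refine le_trans (by linarith) (h4.trans (prob_mono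
    (fun i => ⟨hpmin.le.trans (hp i).1, (hp i).2⟩) fun S hS x hx => ?_))
  obtain ⟨v, hv, hd⟩ := hS x hx
  exact ⟨v, hv, hd.trans hle⟩

/-! ### Chains of relays -/

section Relays

variable {m : ℕ} {S : Finset (Grid m)} {ρ lam : ℝ} {rep : Plane → Grid m}

lemma ChainJoined.mono {ρ' : ℝ} {R R' : List (Grid m)} {s z : Grid m} (h : ChainJoined ρ R s z)
    (hρ : ρ ≤ ρ') (hR : R ⊆ R') : ChainJoined ρ' R' s z :=
  Relation.ReflTransGen.mono (fun _ _ huw => ⟨hR huw.1, huw.2.trans hρ⟩) _ _ h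

/-- The representative of `y` is a relay, and is joined to `s` by a chain of relays. -/
def Linked (rep : Plane → Grid m) (ρ : ℝ) (R : List (Grid m)) (s : Grid m) (y : Plane) : Prop :=
  rep y ∈ R ∧ ChainJoined ρ R s (rep y)

lemma Linked.mono {R R' : List (Grid m)} {s : Grid m} {y : Plane} (h : Linked rep ρ R s y)
    (hR : R ⊆ R') : Linked rep ρ R' s y :=
  ⟨hR h.1, h.2.mono le_rfl hR⟩

/-- Chains glue because `rep` is one fixed function: each piece starts at the very node where the
previous one ended. -/
lemma Linked.trans {R : List (Grid m)} {s : Grid m} {x y : Plane} (h : Linked rep ρ R s x)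
    (h' : Linked rep ρ R (rep x) y) : Linked rep ρ R s y :=
  ⟨h'.1, Relation.ReflTransGen.trans h.2 h'.2⟩

/-- `rep` maps every point of the square to a node at distance at most `ρ`. -/
def IsRep (S : Finset (Grid m)) (ρ : ℝ) (rep : Plane → Grid m) : Prop :=
  ∀ x ∈ square m, rep x ∈ S ∧ dist (pos (rep x)) x ≤ ρ

lemma Dense.exists_isRep (hm : 1 ≤ m) (h : Dense m ρ S) : ∃ rep, IsRep S ρ rep := by
  have : Nonempty (Grid m) := ⟨(⟨0, hm⟩, ⟨0, hm⟩)⟩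
  choose! f hf using h
  exact ⟨f, hf⟩

/-- Sample the segment at `N + 2` points, endpoints included, with spacing at most `lam`; replacing
two neighbours by their representatives adds at most `2 * ρ` to their distance. -/
lemma exists_segment (hrep : IsRep S ρ rep) (hlam : 0 < lam) {x y : Plane} {d : ℝ}
    (hx : x ∈ square m) (hy : y ∈ square m) (hd : dist x y ≤ d) :
    ∃ R : List (Grid m), (∀ v ∈ R, v ∈ S) ∧ (R.length : ℝ) ≤ d / lam + 2 ∧
      Linked rep (2 * ρ + lam) R (rep x) y := by
  have hd0 : 0 ≤ d := dist_nonneg.trans hd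
  set N := ⌊d / lam⌋₊ with hN
  have hN1 : (N : ℝ) ≤ d / lam := Nat.floor_le (by positivity)
  have hN2 : d / lam < N + 1 := Nat.lt_floor_add_one _
  have hN0 : (0 : ℝ) < N + 1 := by positivity
  set P : ℕ → Plane := fun i => AffineMap.lineMap x y ((i : ℝ) / (N + 1)) with hP
  have hP0 : P 0 = x := by simp [hP]
  have hP1 : P (N + 1) = y := by simp [hP, div_self hN0.ne']
  have hPmem : ∀ i ≤ N + 1, P i ∈ square m := fun i hi => by
    refine (convex_square m).lineMap_mem hx hy ⟨by positivity, ?_⟩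
    rw [div_le_one hN0]; exact_mod_cast hi
  have hstep : ∀ i, dist (P i) (P (i + 1)) ≤ lam := fun i => by
    rw [hP]
    simp only [dist_lineMap_lineMap]
    have : dist ((i : ℝ) / (N + 1)) (((i + 1 : ℕ) : ℝ) / (N + 1)) = 1 / (N + 1) := by
      rw [dist_comm, Real.dist_eq, ← sub_div, Nat.cast_succ, add_sub_cancel_left,
        abs_of_pos (by positivity)]
    rw [this, div_mul_eq_mul_div, one_mul, div_le_iff₀ hN0]
    rw [div_lt_iff₀ hlam] at hN2
    linarith
  refine ⟨(List.range (N + 2)).map fun i => rep (P i), ?_, ?_, ?_, ?_⟩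
  · intro v hv
    obtain ⟨i, hi, rfl⟩ := List.mem_map.1 hv
    exact (hrep _ (hPmem i (by have := List.mem_range.1 hi; omega))).1
  · simp only [List.length_map, List.length_range]; push_cast; linarith
  · exact List.mem_map.2 ⟨N + 1, by simp, by rw [hP1]⟩
  · suffices ∀ j ≤ N + 1, ChainJoined (2 * ρ + lam) ((List.range (N + 2)).map fun i => rep (P i))
        (rep x) (rep (P j)) by
      have := this (N + 1) le_rfl
      rwa [hP1] at this
    intro j hj
    induction j with
    | zero => rw [hP0]; exact Relation.ReflTransGen.refl
    | succ j ih =>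
      refine Relation.ReflTransGen.tail (ih (by omega))
        ⟨List.mem_map.2 ⟨j, List.mem_range.2 (by omega), rfl⟩, ?_⟩
      have h1 := (hrep _ (hPmem j (by omega))).2
      have h2 := (hrep _ (hPmem (j + 1) hj)).2
      rw [dist_comm] at h2
      have h3 := dist_triangle4 (pos (rep (P j))) (P j) (P (j + 1)) (pos (rep (P (j + 1))))
      linarith [hstep j]

lemma exists_forall_mem {α : Type*} {L : List α} {b : ℝ} {P : α → List (Grid m) → Prop}
    (hP : ∀ a R R', P a R → R ⊆ R' → P a R')
    (h : ∀ a ∈ L, ∃ R : List (Grid m), (∀ v ∈ R, v ∈ S) ∧ (R.length : ℝ) ≤ b ∧ P a R) :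
    ∃ R : List (Grid m), (∀ v ∈ R, v ∈ S) ∧ (R.length : ℝ) ≤ L.length * b ∧ ∀ a ∈ L, P a R := by
  induction L with
  | nil => exact ⟨[], by simp, by simp, by simp⟩
  | cons a L ih =>
    obtain ⟨R, h1, h2, h3⟩ := ih fun a' ha' => h a' (List.mem_cons_of_mem _ ha')
    obtain ⟨R', h1', h2', h3'⟩ := h a List.mem_cons_self
    refine ⟨R' ++ R, ?_, ?_, ?_⟩
    · intro v hv
      exact (List.mem_append.1 hv).elim (h1' v) (h1 v)
    · simp only [List.length_append, List.length_cons]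
      push_cast
      linarith
    · intro a' ha'
      rcases List.mem_cons.1 ha' with rfl | ha'
      · exact hP _ _ _ h3' (List.subset_append_left _ _)
      · exact hP _ _ _ (h3 a' ha') (List.subset_append_right _ _)

/-- The points near the centres of the disks of a subdivided triangle: the right-angled vertices
of the triangles and the centres of the octagons. -/
def Triangle.targets (k : ℕ) (T : Triangle) : Set Plane :=
  {y | (∃ T' ∈ T.finalTriangles k, y = T'.o) ∨ ∃ Q ∈ T.octagons k, y = Q.center}

lemma Triangle.mem_targets_succ {k : ℕ} {T : Triangle} {y : Plane} (hy : y ∈ T.targets (k + 1)) :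
    y = T.octagon.center ∨ (∃ T' ∈ T.big, y ∈ T'.targets k) ∨
      ∃ T' ∈ T.small, y ∈ T'.targets (k - 1) := by
  simp only [Triangle.targets, Triangle.finalTriangles_succ, Triangle.octagons_succ, List.mem_cons,
    List.mem_append, List.mem_flatMap, Set.mem_ofPred_eq] at hy ⊢
  rcases hy with ⟨T', ⟨T₁, h1, h2⟩ | ⟨T₁, h1, h2⟩, rfl⟩ |
    ⟨Q, rfl | ⟨T₁, h1, h2⟩ | ⟨T₁, h1, h2⟩, rfl⟩
  · exact Or.inr (Or.inl ⟨T₁, h1, Or.inl ⟨_, h2, rfl⟩⟩)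
  · exact Or.inr (Or.inr ⟨T₁, h1, Or.inl ⟨_, h2, rfl⟩⟩)
  · exact Or.inl rfl
  · exact Or.inr (Or.inl ⟨T₁, h1, Or.inr ⟨_, h2, rfl⟩⟩)
  · exact Or.inr (Or.inr ⟨T₁, h1, Or.inr ⟨_, h2, rfl⟩⟩)

lemma exists_relays_prepend {s : Grid m} {x : Plane} {b b' : ℝ} {Y : Set Plane}
    (h : ∃ R : List (Grid m), (∀ v ∈ R, v ∈ S) ∧ (R.length : ℝ) ≤ b ∧ Linked rep ρ R s x)
    (h' : ∃ R : List (Grid m), (∀ v ∈ R, v ∈ S) ∧ (R.length : ℝ) ≤ b' ∧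
      ∀ y ∈ Y, Linked rep ρ R (rep x) y) :
    ∃ R : List (Grid m), (∀ v ∈ R, v ∈ S) ∧ (R.length : ℝ) ≤ b + b' ∧
      ∀ y ∈ Y, Linked rep ρ R s y := by
  obtain ⟨R, h1, h2, h3⟩ := h
  obtain ⟨R', h1', h2', h3'⟩ := h'
  refine ⟨R ++ R', ?_, ?_, ?_⟩
  · intro v hv
    exact (List.mem_append.1 hv).elim (h1 v) (h1' v)
  · rw [List.length_append]; push_cast; linarith
  · intro y hy
    exact (h3.mono (List.subset_append_left _ _)).trans
      ((h3' y hy).mono (List.subset_append_right _ _))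

/-- From the right-angled vertex run six segments, to the five child vertices and the octagon
centre. Each has length at most `μ * grow ^ (k + 1)` and needs at most `(c + 2) * grow ^ (k + 1)`
relays, so the recursion is six times `c + 2` times that of `countBound`. -/
lemma Triangle.Good.exists_relays (hrep : IsRep S ρ rep) (hlam : 0 < lam) {c μ : ℝ}
    (hμ : 0 ≤ μ) (hμc : μ ≤ c * lam) {k : ℕ} {T : Triangle}
    (h : T.Good (square m) (μ * grow ^ k)) :
    ∃ R : List (Grid m), (∀ v ∈ R, v ∈ S) ∧ (R.length : ℝ) ≤ 6 * (c + 2) * countBound k ∧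
      ∀ y ∈ T.targets k, Linked rep (2 * ρ + lam) R (rep T.o) y := by
  have hA := convex_square m
  have hc : 0 ≤ c := by
    by_contra! hc; nlinarith
  refine Triangle.Good.induction hA hμ
    (P := fun k T => ∃ R : List (Grid m), (∀ v ∈ R, v ∈ S) ∧
      (R.length : ℝ) ≤ 6 * (c + 2) * countBound k ∧
      ∀ y ∈ T.targets k, Linked rep (2 * ρ + lam) R (rep T.o) y) ?_ ?_ k T h
  · intro T hT
    refine ⟨[rep T.o], by simpa using (hrep _ hT.o_mem).1, ?_, ?_⟩
    · simp only [List.length_singleton, Nat.cast_one]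
      nlinarith [one_le_countBound_zero]
    · rintro y (⟨T', hT', rfl⟩ | ⟨Q, hQ, rfl⟩)
      · rw [Triangle.finalTriangles, List.mem_singleton] at hT'
        subst hT'
        exact ⟨by simp, Relation.ReflTransGen.refl⟩
      · simp [Triangle.octagons] at hQ
  · intro k T hT h1 h2
    have hseg : ∀ y ∈ square m, dist T.o y ≤ μ * grow ^ (k + 1) →
        ∃ R : List (Grid m), (∀ v ∈ R, v ∈ S) ∧ (R.length : ℝ) ≤ (c + 2) * grow ^ (k + 1) ∧
          Linked rep (2 * ρ + lam) R (rep T.o) y := fun y hy hd => by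
      obtain ⟨R, e1, e2, e3⟩ := exists_segment hrep hlam hT.o_mem hy hd
      refine ⟨R, e1, e2.trans ?_, e3⟩
      have h5 : (1 : ℝ) ≤ grow ^ (k + 1) := one_le_pow₀ one_le_grow
      have h6 : μ * grow ^ (k + 1) / lam ≤ c * grow ^ (k + 1) := by
        rw [div_le_iff₀ hlam]; nlinarith
      linarith
    obtain ⟨R₁, a1, b1, c1⟩ := exists_forall_mem (L := T.big)
      (P := fun T' R => ∀ y ∈ T'.targets k, Linked rep (2 * ρ + lam) R (rep T.o) y)
      (fun _ _ _ h hR y hy => (h y hy).mono hR) (fun T' hT' => exists_relays_prepend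
        (hseg T'.o (hT.big' hA hT').o_mem (hT.dist_child_le (List.mem_append_left _ hT')))
        (h1 T' hT'))
    obtain ⟨R₂, a2, b2, c2⟩ := exists_forall_mem (L := T.small)
      (P := fun T' R => ∀ y ∈ T'.targets (k - 1), Linked rep (2 * ρ + lam) R (rep T.o) y)
      (fun _ _ _ h hR y hy => (h y hy).mono hR) (fun T' hT' => exists_relays_prepend
        (hseg T'.o (hT.small' hA hμ hT').o_mem (hT.dist_child_le (List.mem_append_right _ hT')))
        (h2 T' hT'))
    obtain ⟨R₃, a3, b3, c3⟩ := hseg _ (hT.octagon_center_mem hA) hT.dist_octagon_center_le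
    refine ⟨R₁ ++ (R₂ ++ R₃), ?_, ?_, ?_⟩
    · intro v hv
      rcases List.mem_append.1 hv with hv | hv
      · exact a1 v hv
      · exact (List.mem_append.1 hv).elim (a2 v) (a3 v)
    · have := mul_le_mul_of_nonneg_left (countBound_succ k) (show 0 ≤ 6 * (c + 2) by linarith)
      simp only [Triangle.big, Triangle.small, List.length_cons, List.length_nil] at b1 b2
      simp only [List.length_append]
      push_cast at b1 b2 ⊢
      linarith
    · intro y hy
      rcases Triangle.mem_targets_succ hy with rfl | ⟨T', hT', hy⟩ | ⟨T', hT', hy⟩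
      · exact c3.mono (List.subset_append_of_subset_right _ (List.subset_append_right _ _))
      · exact (c1 T' hT' y hy).mono (List.subset_append_left _ _)
      · exact (c2 T' hT' y hy).mono
          (List.subset_append_of_subset_right _ (List.subset_append_left _ _))

/-- Five further segments lead from the source to the four corners and to the centre of the square;
`240 = 4 * 6 * 10`. -/
lemma exists_relays {c : ℝ} (hrep : IsRep S ρ rep) (hρ : 0 ≤ ρ) (hc : 0 < c)
    (hm : 0 < sqrtLog m) {s : Grid m} (hs : s ∈ S) :
    ∃ R : List (Grid m), (∀ v ∈ R, v ∈ S) ∧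
      (R.length : ℝ) ≤ 5 * (2 * m / sqrtLog m + 3) + 240 * (c + 2) * 3 ^ depth m c ∧
      (∀ T ∈ triangles m c, Linked rep (2 * ρ + sqrtLog m) R s T.o) ∧
      ∀ Q ∈ octagons m c, Linked rep (2 * ρ + sqrtLog m) R s Q.center := by
  have hseg : ∀ y ∈ square m, ∃ R : List (Grid m), (∀ v ∈ R, v ∈ S) ∧
      (R.length : ℝ) ≤ 2 * m / sqrtLog m + 3 ∧ Linked rep (2 * ρ + sqrtLog m) R s y :=
    fun y hy => by
      obtain ⟨R, h1, h2, h3⟩ := exists_segment hrep hm (pos_mem_square s) hy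
        (dist_le_of_mem_square (pos_mem_square s) hy)
      -- The representative of the position of `s` may be another node, so `s` itself becomes the
      -- first relay.
      refine ⟨s :: R, ?_, ?_, List.mem_cons_of_mem _ h3.1, Relation.ReflTransGen.head
        (b := rep (pos s)) ⟨List.mem_cons_self, ?_⟩ (h3.2.mono le_rfl (List.subset_cons_self _ _))⟩
      · intro v hv
        rcases List.mem_cons.1 hv with rfl | hv
        exacts [hs, h1 v hv]
      · rw [List.length_cons]; push_cast; linarith
      · have := (hrep _ (pos_mem_square s)).2
        rw [dist_comm]; linarith
  obtain ⟨R₁, a1, b1, c1⟩ := exists_forall_mem (L := corners m)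
    (b := (2 * m / sqrtLog m + 3) + 6 * (c + 2) * countBound (depth m c))
    (P := fun T' R => ∀ y ∈ T'.targets (depth m c), Linked rep (2 * ρ + sqrtLog m) R s y)
    (fun _ _ _ h hR y hy => (h y hy).mono hR) (fun T' hT' => exists_relays_prepend
      (hseg T'.o (corners_good hT').o_mem)
      ((corners_good' c hT').exists_relays hrep hm (lastLeg_nonneg m c)
        (lastLeg_lt (by positivity)).le))
  obtain ⟨R₂, a2, b2, c2⟩ := hseg _ (firstOctagon_center_mem m)
  refine ⟨R₁ ++ R₂, ?_, ?_, ?_, ?_⟩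
  · intro v hv
    exact (List.mem_append.1 hv).elim (a1 v) (a2 v)
  · have := mul_le_mul_of_nonneg_left (countBound_le (depth m c))
      (show 0 ≤ 6 * (c + 2) by linarith)
    rw [corners_length] at b1
    rw [List.length_append]
    push_cast at b1 ⊢
    linarith
  · intro T hT
    obtain ⟨T₀, h0, h1⟩ := List.mem_flatMap.1 hT
    exact (c1 T₀ h0 _ (Or.inl ⟨T, h1, rfl⟩)).mono (List.subset_append_left _ _)
  · intro Q hQ
    rcases List.mem_cons.1 hQ with rfl | hQ
    · exact c2.mono (List.subset_append_right _ _)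
    obtain ⟨T₀, h0, h1⟩ := List.mem_flatMap.1 hQ
    exact (c1 T₀ h0 _ (Or.inr ⟨Q, h1, rfl⟩)).mono (List.subset_append_left _ _)

end Relays

/-! ### Range assignments -/

lemma rangeOf_cons {m : ℕ} (d : Disk m) (C : List (Disk m)) (v : Grid m) :
    rangeOf (d :: C) v = if d.center = v then max d.radius (rangeOf C v) else rangeOf C v := by
  unfold rangeOf
  split_ifs with h <;> simp [h]

lemma radius_le_rangeOf {m : ℕ} {C : List (Disk m)} {d : Disk m} (hd : d ∈ C) :
    d.radius ≤ rangeOf C d.center := by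
  induction C with
  | nil => simp at hd
  | cons d' C ih =>
    rw [rangeOf_cons]
    rcases List.mem_cons.1 hd with rfl | hd
    · simp
    · split_ifs
      exacts [(ih hd).trans (le_max_right _ _), ih hd]

/-- The square of a maximum is the square of one of its arguments, hence at most the sum of their
squares. -/
lemma rangeCost_rangeOf_le {m : ℕ} (S : Finset (Grid m)) (C : List (Disk m)) :
    rangeCost S (rangeOf C) ≤ diskCost C := by
  induction C with
  | nil => simp [rangeCost, rangeOf, diskCost]
  | cons d C ih =>
    have h1 : ∀ v, rangeOf (d :: C) v ^ 2
        ≤ (if d.center = v then d.radius ^ 2 else 0) + rangeOf C v ^ 2 := fun v => by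
      rw [rangeOf_cons]
      split_ifs
      · rcases max_cases d.radius (rangeOf C v) with ⟨h, _⟩ | ⟨h, _⟩ <;> rw [h] <;>
          nlinarith [sq_nonneg d.radius, sq_nonneg (rangeOf C v)]
      · simp
    calc rangeCost S (rangeOf (d :: C))
        ≤ ∑ v ∈ S, ((if d.center = v then d.radius ^ 2 else 0) + rangeOf C v ^ 2) :=
          Finset.sum_le_sum fun v _ => h1 v
      _ ≤ d.radius ^ 2 + diskCost C := by
          rw [Finset.sum_add_distrib, Finset.sum_ite_eq]
          refine add_le_add ?_ ih
          split_ifs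
          exacts [le_rfl, sq_nonneg _]
      _ = diskCost (d :: C) := by simp [diskCost]

lemma diskCost_append {m : ℕ} (C C' : List (Disk m)) :
    diskCost (C ++ C') = diskCost C + diskCost C' := by
  simp [diskCost]

lemma diskCost_chainDisks {m : ℕ} (ρ : ℝ) (R : List (Grid m)) :
    diskCost (chainDisks ρ R) = R.length * ρ ^ 2 := by
  simp [diskCost, chainDisks, Function.comp_def]

lemma isBroadcast_of_chains {m : ℕ} {S : Finset (Grid m)} {s : Grid m} {ρ l : ℝ}
    {R : List (Grid m)} {C : List (Disk m)} (hR : ∀ v ∈ R, v ∈ S) (hC : IsCover l S C)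
    (h : ∀ d ∈ C, ChainJoined ρ R s d.center) :
    IsBroadcast S s (rangeOf (C ++ chainDisks ρ R)) := by
  intro v hv
  obtain ⟨d, hd, hdv⟩ := hC.covers v hv
  have hdS := hC.center_mem d hd
  refine Relation.ReflTransGen.tail (b := d.center) ?_ ⟨hdS, hv, hdv.trans
    (radius_le_rangeOf (List.mem_append_left _ hd))⟩
  -- Chains do not record that their nodes lie in `S`, so membership is carried along, backwards
  -- from the centre of the disk.
  refine (Relation.ReflTransGen.head_induction_on (motive := fun a _ => a ∈ S ∧
    Relation.ReflTransGen (fun u w => u ∈ S ∧ w ∈ S ∧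
      dist (pos u) (pos w) ≤ rangeOf (C ++ chainDisks ρ R) u) a d.center) (h d hd)
    ⟨hdS, Relation.ReflTransGen.refl⟩ ?_).2
  rintro a b ⟨ha, hab⟩ - ⟨hb, ih⟩
  refine ⟨hR a ha, Relation.ReflTransGen.head ⟨hR a ha, hb, hab.trans ?_⟩ ih⟩
  exact radius_le_rangeOf (d := ⟨a, ρ⟩)
    (List.mem_append_right _ (List.mem_map.2 ⟨a, ha, rfl⟩))

/-! ### The covering OCT -/

section OCT

variable {m : ℕ} {S : Finset (Grid m)} {c K : ℝ}

/-- A covering OCT exists, if there are nodes near the centres of the octagons. -/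
lemma exists_isOCT (h : ∀ Q ∈ octagons m c, ∃ z ∈ S, dist (pos z) Q.center ≤ K * sqrtLog m) :
    ∃ σ : Selection m, IsOCT c K S σ := by
  classical
  set tri : Triangle → Option (Grid m) := fun T =>
    if h : ∃ v ∈ S, pos v ∈ T.region then some h.choose else none with htri
  set near : Octagon → Option (Grid m) := fun Q =>
    if h : ∃ z ∈ S, dist (pos z) Q.center ≤ K * sqrtLog m then some h.choose else none with hnear
  -- The order of the list serves as order of examination, and the octagon choices are defined by
  -- well-founded recursion on it.
  set rank : Octagon → ℕ := fun Q => (octagons m c).idxOf Q with hrank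
  have wf : WellFounded fun Q' Q : Octagon => rank Q' < rank Q := (measure rank).wf
  -- The triangle disks do not depend on the octagon choices, so a dummy choice avoids circularity.
  set C : List (Disk m) := Selection.triDisks ⟨tri, fun _ => none⟩ c with hC
  let F : (Q : Octagon) → ((Q' : Octagon) → rank Q' < rank Q → Option (Grid m)) →
      Option (Grid m) := fun Q rec =>
    if ∃ v ∈ S, pos v ∈ Q.region ∧ ¬ ((∃ d ∈ C, d.Covers v) ∨
      ∃ Q' ∈ octagons m c, ∃ h : rank Q' < rank Q, ∃ z, rec Q' h = some z ∧
        (octDisk K Q' z).Covers v) then near Q else none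
  set oct : Octagon → Option (Grid m) := wf.fix F with hoct
  have hoct_eq : ∀ Q, oct Q = if ∃ v ∈ S, pos v ∈ Q.region ∧
      ¬ Selection.CoveredBefore ⟨tri, oct⟩ c K rank Q v then near Q else none := fun Q => by
    rw [hoct, wf.fix_eq]
    simp only [F, Selection.CoveredBefore, exists_prop, ← hoct]
    rfl
  refine ⟨⟨tri, oct⟩, ?_, ?_, rank, ?_, ?_⟩
  · intro T _ hT
    exact ⟨hT.choose, hT.choose_spec.1, hT.choose_spec.2, by simp only [htri, dif_pos hT]⟩
  · intro T _ hT
    simp only [htri, dif_neg hT]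
  · intro Q hQ Q' _ hQQ'
    exact (List.idxOf_inj hQ).1 hQQ'
  · intro Q hQ
    refine ⟨fun hv => ?_, fun hv => ?_⟩
    · have hz := h Q hQ
      refine ⟨hz.choose, hz.choose_spec.1, hz.choose_spec.2, ?_⟩
      change oct Q = _
      rw [hoct_eq, if_pos hv]
      simp only [hnear, dif_pos hz]
    · change oct Q = _
      rw [hoct_eq, if_neg hv]

lemma IsOCT.of_mem_triDisks {σ : Selection m} (h : IsOCT c K S σ) {d : Disk m}
    (hd : d ∈ σ.triDisks c) : d.radius = √2 * c * sqrtLog m ∧ d.center ∈ S ∧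
      ∃ T ∈ triangles m c, pos d.center ∈ T.region := by
  obtain ⟨T, hT, hv⟩ := List.mem_filterMap.1 hd
  obtain ⟨v, hv', rfl⟩ := Option.map_eq_some_iff.1 hv
  by_cases hex : ∃ v ∈ S, pos v ∈ T.region
  · obtain ⟨w, hw, hwT, e⟩ := h.tri_some T hT hex
    rw [hv', Option.some_inj] at e
    subst e
    exact ⟨rfl, hw, T, hT, hwT⟩
  · rw [h.tri_none T hT hex] at hv'
    exact absurd hv' (by simp)

lemma IsOCT.of_mem_octDisks {σ : Selection m} (h : IsOCT c K S σ) {d : Disk m}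
    (hd : d ∈ σ.octDisks c K) : K * sqrtLog m ≤ d.radius ∧ d.center ∈ S ∧
      ∃ Q ∈ octagons m c, dist (pos d.center) Q.center ≤ K * sqrtLog m := by
  obtain ⟨Q, hQ, hv⟩ := List.mem_filterMap.1 hd
  obtain ⟨v, hv', rfl⟩ := Option.map_eq_some_iff.1 hv
  obtain ⟨rank, -, h2⟩ := h.oct
  by_cases hex : ∃ v ∈ S, pos v ∈ Q.region ∧ ¬ σ.CoveredBefore c K rank Q v
  · obtain ⟨w, hw, hwQ, e⟩ := (h2 Q hQ).1 hex
    rw [hv', Option.some_inj] at e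
    subst e
    exact ⟨by simpa [octDisk] using Q.radius_nonneg, hw, Q, hQ, hwQ⟩
  · rw [(h2 Q hQ).2 hex] at hv'
    exact absurd hv' (by simp)

/-- A node lies in a tile. In a final triangle, whose diameter is at most `√2` times its leg bound,
the selected node reaches it; in an octagon it is covered earlier or by the octagon's own disk,
whose extra radius compensates for the off-centre position. -/
lemma IsOCT.isCover {σ : Selection m} (h : IsOCT c K S σ) (hc : 0 < c) (hK : 0 < K)
    (hm : 0 < sqrtLog m) : IsCover (min (√2 * c) K * sqrtLog m) S (σ.disks c K) := by
  refine ⟨mul_pos (lt_min (by positivity) hK) hm, ?_, ?_, ?_⟩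
  · intro d hd
    rcases List.mem_append.1 hd with hd | hd
    · rw [(h.of_mem_triDisks hd).1]
      exact mul_le_mul_of_nonneg_right (min_le_left _ _) hm.le
    · exact (mul_le_mul_of_nonneg_right (min_le_right _ _) hm.le).trans (h.of_mem_octDisks hd).1
  · intro d hd
    rcases List.mem_append.1 hd with hd | hd
    exacts [(h.of_mem_triDisks hd).2.1, (h.of_mem_octDisks hd).2.1]
  · intro v hv
    rcases exists_tile c (pos_mem_square v) with ⟨T, hT, hvT⟩ | ⟨Q, hQ, hvQ⟩
    · obtain ⟨w, _, hwT, e⟩ := h.tri_some T hT ⟨v, hv, hvT⟩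
      refine ⟨⟨w, √2 * c * sqrtLog m⟩, List.mem_append_left _
        (List.mem_filterMap.2 ⟨T, hT, by simp [e]⟩), ?_⟩
      refine ((good_of_mem_triangles hT).dist_le hwT hvT).trans ?_
      have := lastLeg_lt (m := m) (c := c) (by positivity)
      simp only
      rw [mul_assoc]
      gcongr
    · obtain ⟨rank, -, h2⟩ := h.oct
      by_cases hcov : σ.CoveredBefore c K rank Q v
      · rcases hcov with ⟨d, hd, hdv⟩ | ⟨Q', hQ', -, z, hz, hcov⟩
        · exact ⟨d, List.mem_append_left _ hd, hdv⟩
        · exact ⟨_, List.mem_append_right _ (List.mem_filterMap.2 ⟨Q', hQ', by rw [hz]; rfl⟩), hcov⟩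
      · obtain ⟨z, _, hzd, hz⟩ := (h2 Q hQ).1 ⟨v, hv, hvQ, hcov⟩
        refine ⟨_, List.mem_append_right _ (List.mem_filterMap.2 ⟨Q, hQ, by rw [hz]; rfl⟩), ?_⟩
        have h3 := (regular_of_mem_octagons hQ).1.dist_center_le hvQ
        have h4 := dist_triangle (pos z) Q.center (pos v)
        simp only [Disk.Covers, octDisk]
        linarith

/-- The last hop goes from the representative of a tile's reference point to the disk centre: at
most `κ + √2 * c` for triangles and `κ + K` for octagons, in units of `sqrtLog m`. Hops between
relays cost `2 * κ + 1`. -/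
lemma IsOCT.chainJoined {σ : Selection m} (h : IsOCT c K S σ) (hc : 0 < c) (hK : 0 < K)
    (hm : 0 < sqrtLog m) {κ : ℝ} (hκ : 0 < κ) {rep : Plane → Grid m}
    (hrep : IsRep S (κ * sqrtLog m) rep) {R : List (Grid m)} {s : Grid m}
    (htri : ∀ T ∈ triangles m c, Linked rep (2 * (κ * sqrtLog m) + sqrtLog m) R s T.o)
    (hoct : ∀ Q ∈ octagons m c, Linked rep (2 * (κ * sqrtLog m) + sqrtLog m) R s Q.center)
    {d : Disk m} (hd : d ∈ σ.disks c K) :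
    ChainJoined ((2 * κ + 1 + √2 * c + K) * sqrtLog m) R s d.center := by
  have h1 : 2 * (κ * sqrtLog m) + sqrtLog m ≤ (2 * κ + 1 + √2 * c + K) * sqrtLog m := by
    have : 0 ≤ (√2 * c + K) * sqrtLog m := by positivity
    linarith
  rcases List.mem_append.1 hd with hd | hd
  · obtain ⟨-, -, T, hT, hdT⟩ := h.of_mem_triDisks hd
    have hgood := good_of_mem_triangles hT
    refine Relation.ReflTransGen.tail ((htri T hT).2.mono h1 (List.Subset.refl _))
      ⟨(htri T hT).1, ?_⟩
    have h2 := (hrep _ hgood.o_mem).2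
    have h3 : dist T.o (pos d.center) ≤ √2 * (c * sqrtLog m) :=
      (hgood.dist_le ⟨0, 0, le_rfl, le_rfl, by norm_num, by simp⟩ hdT).trans
        (by have := lastLeg_lt (m := m) (c := c) (by positivity); gcongr)
    have h4 := dist_triangle (pos (rep T.o)) T.o (pos d.center)
    have : 0 ≤ (κ + 1 + K) * sqrtLog m := by positivity
    linarith
  · obtain ⟨-, -, Q, hQ, hdQ⟩ := h.of_mem_octDisks hd
    refine Relation.ReflTransGen.tail ((hoct Q hQ).2.mono h1 (List.Subset.refl _))
      ⟨(hoct Q hQ).1, ?_⟩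
    have h2 := (hrep _ (regular_of_mem_octagons hQ).2).2
    have h4 := dist_triangle (pos (rep Q.center)) Q.center (pos d.center)
    rw [dist_comm] at hdQ
    have : 0 ≤ (κ + 1 + √2 * c) * sqrtLog m := by positivity
    linarith

end OCT

/-! ### The main theorem -/

lemma sqrt_two_div_four_mul_le {n : ℝ} (hn : 0 ≤ n) : √2 / 4 * n ≤ 1.12 * (n / Real.pi) := by
  have h1 : √2 < 1.4143 := by rw [sqrt_two_eq]; linarith [q_lt]
  have h2 := Real.pi_lt_d4
  have h3 := Real.pi_pos
  have h4 : √2 / 4 ≤ 1.12 / Real.pi := by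
    rw [div_le_div_iff₀ (by norm_num) h3]
    nlinarith [mul_le_mul h1.le h2.le h3.le (by norm_num)]
  calc √2 / 4 * n ≤ 1.12 / Real.pi * n := by gcongr
    _ = _ := by ring

lemma isLittleO_natCast_rpow :
    Asymptotics.IsLittleO Filter.atTop (fun n : ℕ => (n : ℝ) ^ (0.63 : ℝ)) fun n => (n : ℝ) := by
  refine Asymptotics.isLittleO_of_tendsto' ?_ ?_
  · filter_upwards [Filter.eventually_gt_atTop 0] with n hn h
    exact absurd h (by positivity)
  · refine ((tendsto_rpow_neg_atTop (show (0 : ℝ) < 0.37 by norm_num)).comp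
      (tendsto_natCast_atTop_atTop (R := ℝ))).congr' ?_
    filter_upwards [Filter.eventually_gt_atTop 0] with n hn
    have h : (0 : ℝ) < n := by exact_mod_cast hn
    rw [Function.comp_apply, ← Real.rpow_sub_one h.ne']
    norm_num

/-- The factor in the bound for the cost of the relays. -/
noncomputable def relayFactor (c B : ℝ) : ℝ := (25 + 240 * (c + 2) * depthFactor c) * B ^ 2

lemma relayFactor_pos {c B : ℝ} (hc : 0 < c) (hB : 0 < B) : 0 < relayFactor c B := by
  have := depthFactor_pos hc
  unfold relayFactor; positivity

lemma relayCost_le {m : ℕ} {c B : ℝ} {R : List (Grid m)} (hc : 0 < c) (hm : 1 ≤ sqrtLog m)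
    (hm1 : 1 ≤ m)
    (hR : (R.length : ℝ) ≤ 5 * (2 * m / sqrtLog m + 3) + 240 * (c + 2) * 3 ^ depth m c) :
    diskCost (chainDisks (B * sqrtLog m) R) ≤
      relayFactor c B * (sqrtLog m ^ 2 * (m : ℝ) ^ (5 / 4 : ℝ)) := by
  have hm2 : (1 : ℝ) ≤ m := by exact_mod_cast hm1
  have hmm : (m : ℝ) ≤ (m : ℝ) ^ (5 / 4 : ℝ) := Real.self_le_rpow_of_one_le hm2 (by norm_num)
  have h1 : 2 * m / sqrtLog m ≤ 2 * m := div_le_self (by positivity) hm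
  have h2 := mul_le_mul_of_nonneg_left (three_pow_depth_le hc hm hm1)
    (show 0 ≤ 240 * (c + 2) by positivity)
  have h3 : (R.length : ℝ) ≤ (25 + 240 * (c + 2) * depthFactor c) * (m : ℝ) ^ (5 / 4 : ℝ) := by
    linarith
  rw [diskCost_chainDisks]
  calc (R.length : ℝ) * (B * sqrtLog m) ^ 2
      ≤ (25 + 240 * (c + 2) * depthFactor c) * (m : ℝ) ^ (5 / 4 : ℝ) * (B * sqrtLog m) ^ 2 := by
        gcongr
    _ = _ := by unfold relayFactor; ring

end RandomGrid

open RandomGrid in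
theorem mainTheorem2 (pmin pmax c : ℝ) (hpmin : 0 < pmin) (hp : pmin ≤ pmax) (hpmax : pmax < 1)
    (hc : 0 < c) :
    ∃ K₀ : ℝ, 0 < K₀ ∧ ∀ K : ℝ, K₀ ≤ K → ∃ a B D : ℝ, 0 < a ∧ 0 < B ∧ 0 < D ∧ ∃ err : ℕ → ℝ,
      Asymptotics.IsLittleO Filter.atTop err (fun n : ℕ => (n : ℝ)) ∧
      ∃ N : ℕ, ∀ m ≥ N, ∀ n : ℕ, n = m ^ 2 →
        ∀ p : RandomGrid.Grid m → ℝ, (∀ i, pmin ≤ p i ∧ p i ≤ pmax) →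
        RandomGrid.prob p (fun S : Finset (RandomGrid.Grid m) =>
          (∃ σ : RandomGrid.Selection m, RandomGrid.IsOCT c K S σ) ∧
          ∀ σ : RandomGrid.Selection m, RandomGrid.IsOCT c K S σ →
            RandomGrid.IsCover (min (√2 * c) K * √(Real.log n)) S (σ.disks c K) ∧
            RandomGrid.diskCost (σ.disks c K) ≤ 1.12 * (n / Real.pi) + err n ∧
            ∀ s ∈ S, ∃ relays : List (RandomGrid.Grid m),
              (∀ v ∈ relays, v ∈ S) ∧
              (∀ d ∈ σ.disks c K,
                RandomGrid.ChainJoined (B * √(Real.log n)) relays s d.center) ∧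
              RandomGrid.diskCost (RandomGrid.chainDisks (B * √(Real.log n)) relays)
                ≤ D * (n : ℝ) ^ (0.63 : ℝ) ∧
              ∃ r : RandomGrid.Grid m → ℝ,
                r = RandomGrid.rangeOf
                  (σ.disks c K ++ RandomGrid.chainDisks (B * √(Real.log n)) relays) ∧
                RandomGrid.IsBroadcast S s r ∧
                RandomGrid.rangeCost S r
                  ≤ RandomGrid.diskCost (σ.disks c K) + D * (n : ℝ) ^ (0.63 : ℝ) ∧
                RandomGrid.rangeCost S r ≤ 1.12 * (n / Real.pi) + err n)
          ≥ 1 - 1 / (n : ℝ) ^ a := by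
  obtain ⟨κ, hκ, hdense⟩ := exists_prob_dense hpmin (hp.trans_lt hpmax)
  refine ⟨κ, hκ, fun K hK => ?_⟩
  have hK0 : 0 < K := hκ.trans_le hK
  have hB : 0 < 2 * κ + 1 + √2 * c + K := by positivity
  have hD := relayFactor_pos hc hB
  set B := 2 * κ + 1 + √2 * c + K
  set D := relayFactor c B
  -- The exponent 1 reflects the failure probability `1 / m ^ 2 = 1 / n`. The error term holds the
  -- lower order costs of both OCT and the relays.
  refine ⟨1, B, D, one_pos, hB, hD, fun n => (costFactor c K + D) * (n : ℝ) ^ (0.63 : ℝ), ?_, ?_⟩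
  · refine Asymptotics.IsLittleO.const_mul_left ?_ _
    exact isLittleO_natCast_rpow
  obtain ⟨N, hN⟩ := Filter.eventually_atTop.1 (hdense.and (eventually_sqrtLog_sq_mul_le.and
    ((tendsto_sqrtLog.eventually_ge_atTop 1).and (Filter.eventually_ge_atTop 1))))
  refine ⟨N, fun m hmN n hn p hpi => ?_⟩
  obtain ⟨h1, h2, hm, hm1⟩ := hN m hmN
  have hp1 : ∀ i, pmin ≤ p i ∧ p i ≤ 1 := fun i => ⟨(hpi i).1, (hpi i).2.trans hpmax.le⟩
  have hm0 : 0 < sqrtLog m := by linarith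
  have hsq : √(Real.log n) = sqrtLog m := by rw [hn, sqrtLog]; push_cast; rfl
  have hnm : (n : ℝ) = (m : ℝ) ^ 2 := by rw [hn]; push_cast; rfl
  rw [← hn] at h2
  rw [Real.rpow_one, ge_iff_le, hsq, hnm]
  refine (h1 p hp1).trans (prob_mono (fun i => ⟨hpmin.le.trans (hp1 i).1, (hp1 i).2⟩)
    fun S hS => ?_)
  rw [← hnm]
  obtain ⟨rep, hrep⟩ := hS.exists_isRep hm1
  refine ⟨exists_isOCT fun Q hQ => ?_, fun σ hσ => ?_⟩
  · obtain ⟨z, hz, hd⟩ := hS _ (regular_of_mem_octagons hQ).2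
    exact ⟨z, hz, hd.trans (mul_le_mul_of_nonneg_right hK hm0.le)⟩
  have hcover := hσ.isCover hc hK0 hm0
  have hcost : diskCost (σ.disks c K) ≤ 1.12 * (n / Real.pi)
      + costFactor c K * (n : ℝ) ^ (0.63 : ℝ) := by
    refine (diskCost_disks_le hc hK0 hm hm1 σ).trans (add_le_add ?_ ?_)
    · rw [← hnm]; exact sqrt_two_div_four_mul_le (Nat.cast_nonneg n)
    · exact mul_le_mul_of_nonneg_left h2 (costFactor_nonneg hc hK0)
  have hDn : 0 ≤ D * (n : ℝ) ^ (0.63 : ℝ) := by positivity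
  refine ⟨hcover, by linarith, fun s hs => ?_⟩
  obtain ⟨R, hRS, hRl, htri, hoct⟩ := exists_relays hrep (by positivity) hc hm0 hs
  have hchain : ∀ d ∈ σ.disks c K, ChainJoined (B * sqrtLog m) R s d.center :=
    fun d hd => hσ.chainJoined hc hK0 hm0 hκ hrep htri hoct hd
  have hR : diskCost (chainDisks (B * sqrtLog m) R) ≤ D * (n : ℝ) ^ (0.63 : ℝ) :=
    (relayCost_le hc hm hm1 hRl).trans (mul_le_mul_of_nonneg_left h2 hD.le)
  have hrange := rangeCost_rangeOf_le S (σ.disks c K ++ chainDisks (B * sqrtLog m) R)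
  rw [diskCost_append] at hrange
  exact ⟨R, hRS, hchain, hR, _, rfl, isBroadcast_of_chains hRS hcover hchain, by linarith,
    by linarith⟩
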